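/- Proposition (Twin Paradox). Let $(M,g)$ be a time-oriented spacetime, i.e. a smooth $(n+1)$-dimensional manifold $M$ ($n \ge 0$) with a smooth Lorentzian metric $g = \langle\cdot,\cdot\rangle$ of signature $(-,+,\ldots,+)$ and a smooth vector field $T$ with $\langle T, T\rangle < 0$ everywhere; let $p_0 \in M$. A $C^1$ curve $\gamma : [a,b] \to M$, $a<b$, is timelike if $\langle \dot\gamma(t), \dot\gamma(t)\rangle < 0$ for all $t \in [a,b]$, and future-directed if moreover $\langle \dot\gamma(t), T_{\gamma(t)}\rangle < 0$ for all $t \in [a,b]$; its length is $\tau(\gamma) = \int_a^b |\langle \dot\gamma(t), \dot\gamma(t)\rangle|^{1/2}\, dt$. Geodesics are those of the Levi-Civita connection of $g$. Then there exists an open neighborhood $V \subset M$ of $p_0$ that is geodesically convex (for all $p, q \in V$ there is one and only one geodesic $c : [0,1] \to V$ with $c(0)=p$ and $c(1)=q$) and such that the spacetime $(V,g)$, in which all curves are required to have image in $V$, satisfies the following property. Let $p \in V$ and $q \in I^+(p)$, i.e. let $q$ be the end point of a future-directed timelike curve in $V$ that starts at $p$. Then there is a timelike geodesic $c$ in $V$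 from $p$ to $q$ (unique up to affine reparametrization), and every timelike curve $\gamma : [a,b] \to V$ from $p$ to $q$ satisfies $\tau(\gamma) \le \tau(c)$, with equality if and only if $\gamma$ is a reparametrization of $c$, i.e. if and only if $\gamma = c \circ \varphi$ for a $C^1$ function $\varphi$ with $\varphi' > 0$ that maps $[a,b]$ onto the parameter interval of $c$. -/

import Mathlib

open Set
open scoped Manifold ContDiff Topology

noncomputable section

/-- A smooth Lorentzian metric on a smooth manifold `M` of dimension `n + 1`: a smooth symmetric
`2`-tensor field of signature `(-, +, …, +)`, i.e. every tangent space has a basis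
`e₀, e₁, …, eₙ` in which the metric is `diag(-1, 1, …, 1)`. In particular it is nondegenerate. -/
structure LorentzianMetric (n : ℕ) (M : Type*) [TopologicalSpace M]
    [ChartedSpace (EuclideanSpace ℝ (Fin (n + 1))) M] [IsManifold (𝓡 (n + 1)) ∞ M] where
  /-- The scalar product on each tangent space. -/
  inner (x : M) :
    TangentSpace (𝓡 (n + 1)) x →L[ℝ] TangentSpace (𝓡 (n + 1)) x →L[ℝ] ℝ
  symm (x : M) (v w : TangentSpace (𝓡 (n + 1)) x) : inner x v w = inner x w v
  signature (x : M) : ∃ e : Module.Basis (Fin (n + 1)) ℝ (TangentSpace (𝓡 (n + 1)) x),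
    ∀ i j, inner x (e i) (e j) = if i = j then (if i = 0 then -1 else 1) else 0
  contMDiff : ContMDiff (𝓡 (n + 1))
    ((𝓡 (n + 1)).prod 𝓘(ℝ, EuclideanSpace ℝ (Fin (n + 1)) →L[ℝ]
      EuclideanSpace ℝ (Fin (n + 1)) →L[ℝ] ℝ)) ∞
    (fun x ↦ Bundle.TotalSpace.mk' (EuclideanSpace ℝ (Fin (n + 1)) →L[ℝ]
      EuclideanSpace ℝ (Fin (n + 1)) →L[ℝ] ℝ)
      (E := fun x : M ↦ TangentSpace (𝓡 (n + 1)) x →L[ℝ] TangentSpace (𝓡 (n + 1)) x →L[ℝ] ℝ)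
      x (inner x))

namespace LorentzianMetric

variable {n : ℕ} {M : Type*} [TopologicalSpace M]
  [ChartedSpace (EuclideanSpace ℝ (Fin (n + 1))) M] [IsManifold (𝓡 (n + 1)) ∞ M]

/-- A tangent vector `v` is timelike if `⟨v, v⟩ < 0`. -/
def Timelike (g : LorentzianMetric n M) {x : M} (v : TangentSpace (𝓡 (n + 1)) x) : Prop :=
  g.inner x v v < 0

/-- A time orientation, given by a smooth timelike vector field `T`. -/
structure TimeOrientation (g : LorentzianMetric n M) where
  /-- The timelike vector field. -/
  field (x : M) : TangentSpace (𝓡 (n + 1)) x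
  contMDiff : ContMDiff (𝓡 (n + 1)) (𝓡 (n + 1)).tangent ∞
    (fun x ↦ (⟨x, field x⟩ : TangentBundle (𝓡 (n + 1)) M))
  timelike (x : M) : g.Timelike (field x)

/-- A timelike vector is future-pointing if it has the same time orientation as `T`. -/
def TimeOrientation.FuturePointing {g : LorentzianMetric n M} (o : g.TimeOrientation) {x : M}
    (v : TangentSpace (𝓡 (n + 1)) x) : Prop :=
  g.Timelike v ∧ g.inner x v (o.field x) < 0

/-- The tangent vector at `t` of a curve `γ : [a, b] → M` (one-sided at the end points). -/
def velocity (n : ℕ) {M : Type*} [TopologicalSpace M]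
    [ChartedSpace (EuclideanSpace ℝ (Fin (n + 1))) M]
    (γ : ℝ → M) (a b t : ℝ) : TangentSpace (𝓡 (n + 1)) (γ t) :=
  mfderivWithin 𝓘(ℝ, ℝ) (𝓡 (n + 1)) γ (Icc a b) t (1 : ℝ)

/-- `γ : [a, b] → V` is a timelike curve from `p` to `q` with image in `V`, i.e. a timelike curve
of the spacetime `(V, g)`. Curves are functions on `ℝ` of which only the values on `[a, b]`
matter. -/
structure IsTimelikeCurve (g : LorentzianMetric n M) (V : Set M) (γ : ℝ → M) (a b : ℝ)
    (p q : M) : Prop where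
  lt : a < b
  contMDiffOn : ContMDiffOn 𝓘(ℝ, ℝ) (𝓡 (n + 1)) 1 γ (Icc a b)
  mapsTo : MapsTo γ (Icc a b) V
  source : γ a = p
  target : γ b = q
  timelike : ∀ t ∈ Icc a b, g.Timelike (velocity n γ a b t)

/-- The chronological future `I⁺(p)` of `p` in the spacetime `(V, g)`: the points to which `p` can
be connected by a future-directed timelike curve in `V`. -/
def TimeOrientation.chronologicalFuture {g : LorentzianMetric n M} (o : g.TimeOrientation)
    (V : Set M) (p : M) : Set M :=
  {q | ∃ (γ : ℝ → M) (a b : ℝ), g.IsTimelikeCurve V γ a b p q ∧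
    ∀ t ∈ Icc a b, o.FuturePointing (velocity n γ a b t)}

/-- The length (proper time) `∫ₐᵇ |γ'(t)| dt`, where `|v| = |⟨v, v⟩|^(1/2)`. -/
def length (g : LorentzianMetric n M) (γ : ℝ → M) (a b : ℝ) : ℝ :=
  ∫ t in a..b, √|g.inner (γ t) (velocity n γ a b t) (velocity n γ a b t)|

/-- The metric coefficients in a chart `e`: the pull-back of `g` by `e.symm`, evaluated at the point
`y` of the target of `e` on the coordinate vectors `u`, `v`. -/
def chartMetric (g : LorentzianMetric n M)
    (e : OpenPartialHomeomorph M (EuclideanSpace ℝ (Fin (n + 1))))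
    (y u v : EuclideanSpace ℝ (Fin (n + 1))) : ℝ :=
  g.inner (e.symm y)
    (mfderiv 𝓘(ℝ, EuclideanSpace ℝ (Fin (n + 1))) (𝓡 (n + 1)) e.symm y u)
    (mfderiv 𝓘(ℝ, EuclideanSpace ℝ (Fin (n + 1))) (𝓡 (n + 1)) e.symm y v)

/-- The Christoffel symbols (of the first kind) of the Levi-Civita connection of `g` in the chart
`e`, extended trilinearly from the coordinate basis:
`⟨∇_u v, w⟩ = ½ (∂_u ⟨v, w⟩ + ∂_v ⟨u, w⟩ - ∂_w ⟨u, v⟩)` for constant coordinate fields. -/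
def christoffel (g : LorentzianMetric n M)
    (e : OpenPartialHomeomorph M (EuclideanSpace ℝ (Fin (n + 1))))
    (y u v w : EuclideanSpace ℝ (Fin (n + 1))) : ℝ :=
  (fderiv ℝ (fun z ↦ g.chartMetric e z v w) y u + fderiv ℝ (fun z ↦ g.chartMetric e z u w) y v
    - fderiv ℝ (fun z ↦ g.chartMetric e z u v) y w) / 2

/-- `c : [a, b] → V` is a geodesic of `g` from `p` to `q` with image in `V`: in every chart `e` of
the manifold, the coordinate expression `x = e ∘ c` satisfies the geodesic equation `D x' / dt = 0`,
written with the index lowered: `⟨x'', w⟩ + Γ(x', x', w) = 0` for all `w` (this is equivalent since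
the metric is nondegenerate). -/
structure IsGeodesic (g : LorentzianMetric n M) (V : Set M) (c : ℝ → M) (a b : ℝ)
    (p q : M) : Prop where
  lt : a < b
  contMDiffOn : ContMDiffOn 𝓘(ℝ, ℝ) (𝓡 (n + 1)) 2 c (Icc a b)
  mapsTo : MapsTo c (Icc a b) V
  source : c a = p
  target : c b = q
  geodesic_eq : ∀ e ∈ atlas (EuclideanSpace ℝ (Fin (n + 1))) M, ∀ t ∈ Icc a b, c t ∈ e.source →
    ∀ w : EuclideanSpace ℝ (Fin (n + 1)),
      g.chartMetric e (e (c t))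
          (derivWithin (derivWithin (e ∘ c) (Icc a b)) (Icc a b) t) w
        + g.christoffel e (e (c t)) (derivWithin (e ∘ c) (Icc a b) t)
          (derivWithin (e ∘ c) (Icc a b) t) w = 0

/-- `V` is geodesically convex: any two points `p`, `q` of `V` are joined by a geodesic
`[0, 1] → V`, and by only one. -/
def GeodesicallyConvex (g : LorentzianMetric n M) (V : Set M) : Prop :=
  ∀ p ∈ V, ∀ q ∈ V, (∃ c : ℝ → M, g.IsGeodesic V c 0 1 p q) ∧
    ∀ c c' : ℝ → M, g.IsGeodesic V c 0 1 p q → g.IsGeodesic V c' 0 1 p q →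
      EqOn c c' (Icc 0 1)

end LorentzianMetric

/-- `γ : [a, b] → M` is a reparametrization of `c : [a', b'] → M`: `γ = c ∘ φ` for an
orientation-preserving diffeomorphism `φ : [a, b] → [a', b']`. -/
def IsReparametrization {M : Type*} (γ : ℝ → M) (a b : ℝ) (c : ℝ → M) (a' b' : ℝ) : Prop :=
  ∃ φ : ℝ → ℝ, ContDiffOn ℝ 1 φ (Icc a b) ∧ (∀ t ∈ Icc a b, 0 < derivWithin φ (Icc a b) t) ∧
    φ a = a' ∧ φ b = b' ∧ ∀ t ∈ Icc a b, γ t = c (φ t)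

end

/-! In a chart around the given point the metric is a smooth field `G` of Lorentz forms, and
geodesics solve `x'' = B(x)(x', x')`. The neighborhood `V` is a small coordinate ball. There the
two-point boundary problem is solved directly: existence comes from a contraction on accelerations
(`exists_isSprayCurve_mem_ball`), and uniqueness from the estimate that two geodesics with the same
source are as close as their end points (`IsSprayCurve.norm_vel_sub_le`). Neither the exponential
map nor the inverse function theorem is needed.

Fix `p`, let `ξ(q)` be the final velocity at time 1 of the geodesic from `p` to `q`, and put `N(q) =
G(ξ, ξ)`. The Gauss lemma `IsGeodesicFan.hasFDerivAt_energy` says `dN = 2 G(ξ, ·)`. Along a timelike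
curve `γ` from `p`, `N` is negative just after the start, with `G(ξ, γ') < 0`. By the reverse
Cauchy-Schwarz inequality `G(ξ, γ')` cannot vanish while `N < 0`, so both signs persist
(`IsTimelikeCurveIn.neg`). The same inequality gives `(√(-N))' = -G(ξ, γ') / √(-N) ≥ |γ'|`.
Integrating, the length of `γ` is at most `√(-N)` at the end point, which is the length of the
geodesic.

If the lengths agree, equality holds in Cauchy-Schwarz at every time, so `γ'` is a multiple of
`ξ(γ)`. The geodesic, reparametrized by the proper time of `γ`, solves the same first-order
equation, and ODE uniqueness identifies the two (`IsTimelikeCurveIn.eq_geodesic`).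

The remaining work transfers this to `M`: the metric is smooth and Lorentzian in a chart, and the
geodesic equation in one chart implies it in all charts (`GeodesicEq.map`). -/

noncomputable section

/-! ### Linear algebra of Lorentz forms -/

section LorentzForm

variable {n : ℕ} {E : Type*} [NormedAddCommGroup E] [NormedSpace ℝ E]

/-- A symmetric bilinear form of signature `(-, +, …, +)`. -/
structure IsLorentzForm (n : ℕ) (A : E →L[ℝ] E →L[ℝ] ℝ) : Prop where
  symm : ∀ v w, A v w = A w v
  signature : ∃ e : Module.Basis (Fin (n + 1)) ℝ E,
    ∀ i j, A (e i) (e j) = if i = j then (if i = 0 then -1 else 1) else 0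

namespace IsLorentzForm

variable {A : E →L[ℝ] E →L[ℝ] ℝ}

theorem exists_coordinates (hA : IsLorentzForm n A) :
    ∃ e : Module.Basis (Fin (n + 1)) ℝ E, ∀ v w,
      A v w = -(e.repr v 0 * e.repr w 0) + ∑ i : Fin n, e.repr v i.succ * e.repr w i.succ := by
  obtain ⟨e, he⟩ := hA.signature
  refine ⟨e, fun v w ↦ ?_⟩
  conv_lhs => rw [← e.sum_repr v, ← e.sum_repr w]
  simp only [map_sum, map_smul, sum_apply, smul_apply,
    smul_eq_mul, he]
  rw [Fin.sum_univ_succ]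
  simp [Fin.succ_ne_zero, mul_comm]

/-- The orthogonal complement of a timelike vector is spacelike. -/
theorem pos_of_orthogonal (hA : IsLorentzForm n A) {u w : E} (hu : A u u < 0) (huw : A u w = 0)
    (hw : w ≠ 0) : 0 < A w w := by
  obtain ⟨e, he⟩ := hA.exists_coordinates
  rw [he] at hu huw ⊢
  set u0 := e.repr u 0
  set w0 := e.repr w 0
  -- Orthogonality makes the spatial product equal to `u0 * w0`, so Cauchy-Schwarz reads `u0² w0² ≤
  -- a b`, while `a < u0²` as `u` is timelike. Hence `w0² < b`, unless `b = 0`, which forces `w =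
  -- 0`.
  have hcs := Finset.sum_mul_sq_le_sq_mul_sq Finset.univ (fun i : Fin n ↦ e.repr u i.succ)
    (fun i : Fin n ↦ e.repr w i.succ)
  simp only [← sq] at hu ⊢
  set a := ∑ i : Fin n, (e.repr u i.succ) ^ 2
  set b := ∑ i : Fin n, (e.repr w i.succ) ^ 2 with hb
  set s := ∑ i : Fin n, e.repr u i.succ * e.repr w i.succ
  have ha0 : 0 ≤ a := Finset.sum_nonneg fun i _ ↦ sq_nonneg _
  have hb0 : 0 ≤ b := Finset.sum_nonneg fun i _ ↦ sq_nonneg _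
  have hs : s = u0 * w0 := by linarith
  rw [hs] at hcs
  have hu0 : 0 < u0 ^ 2 := by linarith
  rcases hb0.eq_or_lt with hb1 | hb1
  · exfalso
    apply hw
    rw [← hb1, mul_zero, mul_pow] at hcs
    have hw0 : w0 ^ 2 = 0 := by
      by_contra h
      have : 0 < w0 ^ 2 := lt_of_le_of_ne (sq_nonneg _) (Ne.symm h)
      nlinarith [mul_pos hu0 this]
    have hi : ∀ i : Fin n, e.repr w i.succ = 0 := fun i ↦ by
      have := (Finset.sum_eq_zero_iff_of_nonneg (fun i _ ↦ sq_nonneg _)).1 (hb.symm.trans hb1.symm)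
        i (Finset.mem_univ i)
      exact pow_eq_zero_iff (two_ne_zero) |>.1 this
    rw [← e.repr.map_eq_zero_iff]
    ext i
    refine Fin.cases ?_ (fun i ↦ ?_) i
    · exact pow_eq_zero_iff (two_ne_zero) |>.1 hw0
    · exact hi i
  · have h1 : u0 ^ 2 * w0 ^ 2 < u0 ^ 2 * b := by nlinarith
    have := lt_of_mul_lt_mul_left h1 hu0.le
    linarith

theorem nonneg_of_orthogonal (hA : IsLorentzForm n A) {u w : E} (hu : A u u < 0)
    (huw : A u w = 0) : 0 ≤ A w w := by
  by_cases hw : w = 0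
  · simp [hw]
  · exact (hA.pos_of_orthogonal hu huw hw).le

/-- The defect in the reverse Cauchy-Schwarz inequality is `-A u u` times the square of the part of
`v` orthogonal to `u`. Its sign gives the inequality, its vanishing the equality case. -/
theorem orthogonal_part (hA : IsLorentzForm n A) {u : E} (hu : A u u < 0) (v : E) :
    A u (v - (A u v / A u u) • u) = 0 ∧
      A u v ^ 2 = A u u * A v v
        - A u u * A (v - (A u v / A u u) • u) (v - (A u v / A u u) • u) := by
  have h := hu.ne
  constructor
  · simp only [map_sub, map_smul, smul_eq_mul]
    field_simp
    ring
  · simp only [map_sub, map_smul, smul_eq_mul, sub_apply,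
      smul_apply, hA.symm v u]
    field_simp
    ring

/-- The reverse Cauchy-Schwarz inequality. -/
theorem mul_le_sq (hA : IsLorentzForm n A) {u : E} (hu : A u u < 0) (v : E) :
    A u u * A v v ≤ A u v ^ 2 := by
  obtain ⟨h1, h2⟩ := hA.orthogonal_part hu v
  nlinarith [hA.nonneg_of_orthogonal hu h1]

/-- The equality case of the reverse Cauchy-Schwarz inequality. -/
theorem eq_smul_of_mul_eq_sq (hA : IsLorentzForm n A) {u v : E} (hu : A u u < 0)
    (h : A u u * A v v = A u v ^ 2) : v = (A u v / A u u) • u := by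
  obtain ⟨h1, h2⟩ := hA.orthogonal_part hu v
  by_contra hne
  have := hA.pos_of_orthogonal hu h1 (sub_ne_zero.2 hne)
  nlinarith

theorem injective (hA : IsLorentzForm n A) : Function.Injective A := by
  obtain ⟨e, he⟩ := hA.signature
  rw [injective_iff_map_eq_zero]
  intro v hv
  rw [← e.repr.map_eq_zero_iff]
  ext j
  have h : A v (e j) = 0 := by simp [hv]
  rw [← e.sum_repr v] at h
  simp only [map_sum, map_smul, sum_apply, smul_apply,
    smul_eq_mul, he] at h
  by_cases hj : j = 0 <;> simpa [hj] using h

end IsLorentzForm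

end LorentzForm

/-! ### A priori estimates for slow geodesics -/

section Spray

variable {E : Type*} [NormedAddCommGroup E] [NormedSpace ℝ E]

/-- `x` solves the geodesic equation `x'' = B(x)(x', x')` on `[0, 1]`, with velocity `v`. -/
structure IsSprayCurve (B : E → E →L[ℝ] E →L[ℝ] E) (x v : ℝ → E) : Prop where
  hasDeriv : ∀ t ∈ Icc (0 : ℝ) 1, HasDerivWithinAt x (v t) (Icc 0 1) t
  hasDeriv_vel : ∀ t ∈ Icc (0 : ℝ) 1, HasDerivWithinAt v (B (x t) (v t) (v t)) (Icc 0 1) t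

variable {B : E → E →L[ℝ] E →L[ℝ] E} {C r S : ℝ} {x v y w : ℝ → E}

theorem norm_quadratic_le (hB : ∀ y, ‖B y‖ ≤ C) (y v : E) (hv : ‖v‖ ≤ S) :
    ‖B y v v‖ ≤ C * S ^ 2 := by
  have hC : 0 ≤ C := (norm_nonneg (B y)).trans (hB y)
  calc ‖B y v v‖ ≤ ‖B y‖ * ‖v‖ * ‖v‖ := (B y).le_opNorm₂ v v
    _ ≤ C * S * S := by
      have := norm_nonneg v
      gcongr
      exacts [mul_nonneg hC (this.trans hv), hB y]
    _ = C * S ^ 2 := by ring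

theorem norm_quadratic_sub_le (hB : ∀ y, ‖B y‖ ≤ C) (hL : ∀ y z, ‖B y - B z‖ ≤ C * ‖y - z‖)
    {y z v w : E} (hv : ‖v‖ ≤ S) (hw : ‖w‖ ≤ S) :
    ‖B y v v - B z w w‖ ≤ C * S ^ 2 * ‖y - z‖ + 2 * C * S * ‖v - w‖ := by
  have hC : 0 ≤ C := (norm_nonneg (B y)).trans (hB y)
  have hS : 0 ≤ S := (norm_nonneg _).trans hv
  have e : B y v v - B z w w = (B y - B z) v v + B z (v - w) v + B z w (v - w) := by
    simp
  have h1 : ‖(B y - B z) v v‖ ≤ C * ‖y - z‖ * S * S :=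
    ((B y - B z).le_opNorm₂ v v).trans (by gcongr; exact hL y z)
  have h2 : ‖B z (v - w) v‖ ≤ C * ‖v - w‖ * S :=
    ((B z).le_opNorm₂ _ _).trans (by gcongr; exact hB z)
  have h3 : ‖B z w (v - w)‖ ≤ C * S * ‖v - w‖ :=
    ((B z).le_opNorm₂ _ _).trans (by gcongr; exact hB z)
  rw [e]
  refine (norm_add₃_le).trans ?_
  linarith

theorem continuous_of_norm_sub_le (hC : 0 ≤ C) (hL : ∀ y z, ‖B y - B z‖ ≤ C * ‖y - z‖) :
    Continuous B :=
  (LipschitzWith.of_dist_le_mul (K := C.toNNReal) (f := B) fun y z ↦ by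
    rw [Real.coe_toNNReal C hC, dist_eq_norm y z]
    exact (dist_eq_norm (B y) (B z)).trans_le (hL y z)).continuous

namespace IsSprayCurve

theorem continuousOn (h : IsSprayCurve B x v) : ContinuousOn x (Icc 0 1) :=
  fun t ht ↦ (h.hasDeriv t ht).continuousWithinAt

theorem continuousOn_vel (h : IsSprayCurve B x v) : ContinuousOn v (Icc 0 1) :=
  fun t ht ↦ (h.hasDeriv_vel t ht).continuousWithinAt

theorem const (p : E) : IsSprayCurve B (fun _ ↦ p) (fun _ ↦ 0) where
  hasDeriv t _ := hasDerivWithinAt_const t _ p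
  hasDeriv_vel t _ := by simpa using hasDerivWithinAt_const t (Icc (0 : ℝ) 1) (0 : E)

/-- The restriction of a geodesic to `[0, s]`, reparametrized by `[0, 1]`. -/
theorem rescale (h : IsSprayCurve B x v) {s : ℝ} (hs : s ∈ Icc (0 : ℝ) 1) :
    IsSprayCurve B (fun t ↦ x (s * t)) (fun t ↦ s • v (s * t)) := by
  have hm : MapsTo (fun t ↦ s * t) (Icc (0 : ℝ) 1) (Icc 0 1) := fun t ht ↦
    ⟨mul_nonneg hs.1 ht.1, mul_le_one₀ hs.2 ht.1 ht.2⟩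
  have hd : ∀ t : ℝ, HasDerivWithinAt (fun t ↦ s * t) s (Icc 0 1) t := fun t ↦ by
    simpa using ((hasDerivAt_id t).const_mul s).hasDerivWithinAt
  refine ⟨fun t ht ↦ (h.hasDeriv _ (hm ht)).scomp t (hd t) hm, fun t ht ↦ ?_⟩
  simp only [map_smul, smul_apply]
  exact ((h.hasDeriv_vel _ (hm ht)).scomp t (hd t) hm).const_smul s

/-- A geodesic inside a small ball has small speed. -/
theorem speed_le (h : IsSprayCurve B x v) (hB : ∀ y, ‖B y‖ ≤ C) (hC : 0 < C) {y₀ : E}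
    (hx : ∀ t ∈ Icc (0 : ℝ) 1, x t ∈ Metric.ball y₀ r) (hr : 8 * C * r ≤ 1) :
    ∀ t ∈ Icc (0 : ℝ) 1, ‖v t‖ ≤ 8 * r := by
  obtain ⟨t₀, ht₀, hmax⟩ := isCompact_Icc.exists_isMaxOn (nonempty_Icc.2 zero_le_one)
    h.continuousOn_vel.norm
  have hmax : ∀ t ∈ Icc (0 : ℝ) 1, ‖v t‖ ≤ ‖v t₀‖ := hmax
  suffices hm : ‖v t₀‖ ≤ 8 * r from fun t ht ↦ (hmax t ht).trans hm
  set m := ‖v t₀‖ with hm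
  have hr0 : 0 < r := Metric.pos_of_mem_ball (hx t₀ ht₀)
  by_contra! hmr
  have hm0 : 0 < m := by linarith
  have hosc : ∀ t ∈ Icc (0 : ℝ) 1, ∀ s ∈ Icc (0 : ℝ) 1, ‖v t - v s‖ ≤ C * m ^ 2 * |t - s| := by
    intro t ht s hs
    exact (convex_Icc (0 : ℝ) 1).norm_image_sub_le_of_norm_hasDerivWithin_le h.hasDeriv_vel
      (fun u hu ↦ norm_quadratic_le hB _ _ (hmax u hu)) hs ht
  -- In a time `k` the velocity changes by at most `m / 2`, and `k ≤ 1/2` leaves room in `[0, 1]` on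
  -- one side of `t₀`. The curve therefore moves by at least `k * m / 2`, yet by less than `2 * r`.
  -- Either value of `k` then contradicts `8 * r < m` or `8 * C * r ≤ 1`.
  set k := min (1 / 2) (1 / (2 * C * m)) with hk
  have hk0 : 0 < k := by positivity
  have hk1 : k ≤ 1 / 2 := min_le_left _ _
  have hk2 : C * m * k ≤ 1 / 2 := by
    have : k ≤ 1 / (2 * C * m) := min_le_right _ _
    rw [le_div_iff₀ (by positivity)] at this
    linarith
  obtain ⟨s, hs, hsk⟩ : ∃ s ∈ Icc (0 : ℝ) 1, |s - t₀| = k := by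
    rcases le_total t₀ (1 / 2) with h1 | h1
    · exact ⟨t₀ + k, ⟨by linarith [ht₀.1], by linarith⟩, by rw [add_sub_cancel_left, abs_of_pos hk0]⟩
    · exact ⟨t₀ - k, ⟨by linarith, by linarith [ht₀.2]⟩, by
        rw [sub_sub_cancel_left, abs_neg, abs_of_pos hk0]⟩
  have hsub : uIcc t₀ s ⊆ Icc (0 : ℝ) 1 := ordConnected_Icc.uIcc_subset ht₀ hs
  have hlin : ‖(x s - s • v t₀) - (x t₀ - t₀ • v t₀)‖ ≤ (C * m ^ 2 * k) * |s - t₀| := by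
    refine (convex_uIcc t₀ s).norm_image_sub_le_of_norm_hasDerivWithin_le
      (f := fun t ↦ x t - t • v t₀) (f' := fun t ↦ v t - (1 : ℝ) • v t₀)
      (fun t ht ↦ ?_) (fun t ht ↦ ?_) left_mem_uIcc right_mem_uIcc
    · exact ((h.hasDeriv t (hsub ht)).mono hsub).sub ((hasDerivWithinAt_id t _).smul_const _)
    · rw [one_smul]
      refine (hosc t (hsub ht) t₀ ht₀).trans ?_
      have : |t - t₀| ≤ k := hsk ▸ abs_sub_left_of_mem_uIcc ht
      gcongr
  rw [hsk] at hlin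
  have hdist : ‖x s - x t₀‖ < 2 * r := by
    have h1 := hx s hs
    have h2 := hx t₀ ht₀
    rw [mem_ball_iff_norm] at h1 h2
    calc ‖x s - x t₀‖ = ‖(x s - y₀) - (x t₀ - y₀)‖ := by congr 1; abel
      _ ≤ ‖x s - y₀‖ + ‖x t₀ - y₀‖ := norm_sub_le _ _
      _ < 2 * r := by linarith
  have hvk : k * m ≤ ‖x s - x t₀‖ + C * m ^ 2 * k * k := by
    have h1 : ‖(s - t₀) • v t₀‖ = k * m := by rw [norm_smul, Real.norm_eq_abs, hsk]
    rw [← h1]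
    calc ‖(s - t₀) • v t₀‖
        = ‖(x s - x t₀) - ((x s - s • v t₀) - (x t₀ - t₀ • v t₀))‖ := by
          congr 1; rw [sub_smul]; abel
      _ ≤ _ := (norm_sub_le _ _).trans (by gcongr)
  have hkm : k * m < 4 * r := by nlinarith [mul_le_mul_of_nonneg_left hk2 (mul_pos hk0 hm0).le]
  rcases min_choice (1 / 2 : ℝ) (1 / (2 * C * m)) with h1 | h1
  · rw [← hk] at h1
    rw [h1] at hkm
    linarith
  · rw [← hk] at h1
    have h2 : 2 * (C * (k * m)) = 1 := by rw [h1]; field_simp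
    nlinarith

/-- Two slow geodesics with the same initial point are as close as their end points. -/
theorem norm_vel_sub_le (hx : IsSprayCurve B x v) (hy : IsSprayCurve B y w) (hB : ∀ y, ‖B y‖ ≤ C)
    (hL : ∀ y z, ‖B y - B z‖ ≤ C * ‖y - z‖) (hv : ∀ t ∈ Icc (0 : ℝ) 1, ‖v t‖ ≤ S)
    (hw : ∀ t ∈ Icc (0 : ℝ) 1, ‖w t‖ ≤ S) (hS : C * S ^ 2 + 2 * C * S ≤ 1 / 2) (h0 : x 0 = y 0) :
    ∀ t ∈ Icc (0 : ℝ) 1, ‖w t - v t‖ ≤ 2 * ‖y 1 - x 1‖ ∧ ‖y t - x t‖ ≤ 2 * ‖y 1 - x 1‖ := by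
  have h01 : (0 : ℝ) ∈ Icc (0 : ℝ) 1 := ⟨le_rfl, zero_le_one⟩
  have h11 : (1 : ℝ) ∈ Icc (0 : ℝ) 1 := ⟨zero_le_one, le_rfl⟩
  have hC : 0 ≤ C := (norm_nonneg (B (x 0))).trans (hB (x 0))
  have hS0 : 0 ≤ S := (norm_nonneg _).trans (hv 0 h01)
  obtain ⟨t₀, ht₀, hmax⟩ := isCompact_Icc.exists_isMaxOn (nonempty_Icc.2 zero_le_one)
    (hy.continuousOn_vel.sub hx.continuousOn_vel).norm
  have hmax : ∀ t ∈ Icc (0 : ℝ) 1, ‖w t - v t‖ ≤ ‖w t₀ - v t₀‖ := hmax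
  set N := ‖w t₀ - v t₀‖
  have hN : 0 ≤ N := norm_nonneg _
  have hz : ∀ t ∈ Icc (0 : ℝ) 1, ‖y t - x t‖ ≤ N := by
    intro t ht
    have := (convex_Icc (0 : ℝ) 1).norm_image_sub_le_of_norm_hasDerivWithin_le
      (fun t ht ↦ (hy.hasDeriv t ht).sub (hx.hasDeriv t ht)) hmax h01 ht
    simp only [h0, Pi.sub_apply, sub_self, sub_zero, Real.norm_eq_abs, abs_of_nonneg ht.1] at this
    exact this.trans (mul_le_of_le_one_right hN ht.2)
  -- Smallness makes the relative acceleration at most `N / 2`. The relative velocity thus stays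
  -- within `N / 2` of its value at `t₀`, whose norm is `N`, and so does its integral `y 1 - x 1`.
  have hacc : ∀ t ∈ Icc (0 : ℝ) 1, ‖B (y t) (w t) (w t) - B (x t) (v t) (v t)‖ ≤ N / 2 := by
    intro t ht
    refine (norm_quadratic_sub_le hB hL (hw t ht) (hv t ht)).trans ?_
    calc C * S ^ 2 * ‖y t - x t‖ + 2 * C * S * ‖w t - v t‖
        ≤ C * S ^ 2 * N + 2 * C * S * N := by gcongr; exacts [hz t ht, hmax t ht]
      _ = (C * S ^ 2 + 2 * C * S) * N := by ring
      _ ≤ 1 / 2 * N := by gcongr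
      _ = N / 2 := by ring
  have hosc : ∀ t ∈ Icc (0 : ℝ) 1, ‖(w t - v t) - (w t₀ - v t₀)‖ ≤ N / 2 := by
    intro t ht
    have := (convex_Icc (0 : ℝ) 1).norm_image_sub_le_of_norm_hasDerivWithin_le
      (fun t ht ↦ (hy.hasDeriv_vel t ht).sub (hx.hasDeriv_vel t ht)) hacc ht₀ ht
    refine this.trans (mul_le_of_le_one_right (by positivity) ?_)
    rw [Real.norm_eq_abs, abs_le]
    constructor <;> linarith [ht.1, ht.2, ht₀.1, ht₀.2]
  have hend : ‖(y 1 - x 1) - (w t₀ - v t₀)‖ ≤ N / 2 := by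
    have := (convex_Icc (0 : ℝ) 1).norm_image_sub_le_of_norm_hasDerivWithin_le
      (f := fun t ↦ (y t - x t) - t • (w t₀ - v t₀)) (f' := fun t ↦ (w t - v t) - (1 : ℝ) • (w t₀ - v t₀))
      (fun t ht ↦ ((hy.hasDeriv t ht).sub (hx.hasDeriv t ht)).sub
        ((hasDerivWithinAt_id t _).smul_const _))
      (fun t ht ↦ by rw [one_smul]; exact hosc t ht) h01 h11
    simpa [h0] using this
  have hN2 : N ≤ 2 * ‖y 1 - x 1‖ := by
    have := norm_sub_norm_le (w t₀ - v t₀) (y 1 - x 1)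
    rw [norm_sub_rev] at hend
    linarith
  exact fun t ht ↦ ⟨(hmax t ht).trans hN2, (hz t ht).trans hN2⟩

/-- The final velocity of a slow geodesic is the difference of its end points, to first order. -/
theorem norm_vel_sub_sub_le (hx : IsSprayCurve B x v) (hB : ∀ y, ‖B y‖ ≤ C)
    (hL : ∀ y z, ‖B y - B z‖ ≤ C * ‖y - z‖) (hv : ∀ t ∈ Icc (0 : ℝ) 1, ‖v t‖ ≤ S)
    (hS : C * S ^ 2 + 2 * C * S ≤ 1 / 2) :
    ‖v 1 - (x 1 - x 0)‖ ≤ 4 * C * ‖x 1 - x 0‖ ^ 2 := by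
  have h01 : (0 : ℝ) ∈ Icc (0 : ℝ) 1 := ⟨le_rfl, zero_le_one⟩
  have h11 : (1 : ℝ) ∈ Icc (0 : ℝ) 1 := ⟨zero_le_one, le_rfl⟩
  have hS0 : 0 ≤ S := (norm_nonneg _).trans (hv 0 h01)
  have hC : 0 ≤ C := (norm_nonneg (B (x 0))).trans (hB (x 0))
  -- The comparison geodesic is the constant one at `x 0`.
  have hspeed : ∀ t ∈ Icc (0 : ℝ) 1, ‖v t‖ ≤ 2 * ‖x 1 - x 0‖ := fun t ht ↦ by
    simpa using ((IsSprayCurve.const (x 0)).norm_vel_sub_le hx hB hL (by simpa using fun _ _ _ ↦ hS0) hv hS rfl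
      t ht).1
  have hosc : ∀ t ∈ Icc (0 : ℝ) 1, ‖v t - v 1‖ ≤ 4 * C * ‖x 1 - x 0‖ ^ 2 := by
    intro t ht
    have := (convex_Icc (0 : ℝ) 1).norm_image_sub_le_of_norm_hasDerivWithin_le hx.hasDeriv_vel
      (fun u hu ↦ norm_quadratic_le hB _ _ (hspeed u hu)) h11 ht
    refine this.trans ?_
    have h1 : ‖t - 1‖ ≤ 1 := by
      rw [Real.norm_eq_abs, abs_le]; constructor <;> linarith [ht.1, ht.2]
    calc C * (2 * ‖x 1 - x 0‖) ^ 2 * ‖t - 1‖ ≤ C * (2 * ‖x 1 - x 0‖) ^ 2 * 1 := by gcongr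
      _ = _ := by ring
  have := (convex_Icc (0 : ℝ) 1).norm_image_sub_le_of_norm_hasDerivWithin_le
    (f := fun t ↦ x t - t • v 1) (f' := fun t ↦ v t - (1 : ℝ) • v 1)
    (fun t ht ↦ (hx.hasDeriv t ht).sub ((hasDerivWithinAt_id t _).smul_const _))
    (fun t ht ↦ by rw [one_smul]; exact hosc t ht) h01 h11
  simp only [one_smul, zero_smul, sub_zero, norm_one, mul_one] at this
  rwa [norm_sub_rev, sub_right_comm]

end IsSprayCurve

end Spray

/-! ### Existence of geodesics between nearby points -/

section SprayExistence

open BoundedContinuousFunction MeasureTheory intervalIntegral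

variable {E : Type*} [NormedAddCommGroup E] [InnerProductSpace ℝ E]

/-- Geodesics inside a small ball stay in the smallest concentric ball containing their end points. -/
theorem IsSprayCurve.norm_sub_le {B : E → E →L[ℝ] E →L[ℝ] E} {C ρ : ℝ} {x v : ℝ → E}
    (h : IsSprayCurve B x v) (hB : ∀ y, ‖B y‖ ≤ C) {y₀ : E}
    (hx : ∀ t ∈ Icc (0 : ℝ) 1, C * ‖x t - y₀‖ ≤ 1) (h0 : ‖x 0 - y₀‖ < ρ) (h1 : ‖x 1 - y₀‖ < ρ) :
    ∀ t ∈ Icc (0 : ℝ) 1, ‖x t - y₀‖ < ρ := by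
  have hd1 : ∀ t ∈ Icc (0 : ℝ) 1, HasDerivWithinAt (fun t ↦ ‖x t - y₀‖ ^ 2)
      (2 * inner ℝ (x t - y₀) (v t)) (Icc 0 1) t := fun t ht ↦
    ((h.hasDeriv t ht).sub_const y₀).norm_sq
  have hd2 : ∀ t ∈ Icc (0 : ℝ) 1, HasDerivWithinAt (fun t ↦ 2 * inner ℝ (x t - y₀) (v t))
      (2 * (inner ℝ (x t - y₀) (B (x t) (v t) (v t)) + inner ℝ (v t) (v t))) (Icc 0 1) t :=
    fun t ht ↦ (((h.hasDeriv t ht).sub_const y₀).inner ℝ (h.hasDeriv_vel t ht)).const_mul 2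
  -- The second derivative is `2 (|v|² + ⟨x - y₀, B(v, v)⟩)`, and the second term is dominated by
  -- the first because `C |x - y₀| ≤ 1`. A convex function is largest at the end points.
  have hconv : ConvexOn ℝ (Icc (0 : ℝ) 1) (fun t ↦ ‖x t - y₀‖ ^ 2) := by
    refine convexOn_of_hasDerivWithinAt2_nonneg (convex_Icc 0 1)
      (fun t ht ↦ (hd1 t ht).continuousWithinAt)
      (fun t ht ↦ (hd1 t (interior_subset ht)).mono interior_subset)
      (fun t ht ↦ (hd2 t (interior_subset ht)).mono interior_subset) (fun t ht ↦ ?_)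
    have h3 := hx t (interior_subset ht)
    have h4 := abs_real_inner_le_norm (x t - y₀) (B (x t) (v t) (v t))
    have h5 := norm_quadratic_le hB (x t) (v t) le_rfl
    rw [real_inner_self_eq_norm_sq]
    have h6 : ‖x t - y₀‖ * ‖B (x t) (v t) (v t)‖ ≤ ‖v t‖ ^ 2 :=
      calc ‖x t - y₀‖ * ‖B (x t) (v t) (v t)‖ ≤ ‖x t - y₀‖ * (C * ‖v t‖ ^ 2) := by gcongr
        _ = C * ‖x t - y₀‖ * ‖v t‖ ^ 2 := by ring
        _ ≤ 1 * ‖v t‖ ^ 2 := by gcongr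
        _ = ‖v t‖ ^ 2 := one_mul _
    linarith [neg_abs_le (inner ℝ (x t - y₀) (B (x t) (v t) (v t)))]
  intro t ht
  have := hconv.le_max_of_mem_Icc (left_mem_Icc.2 zero_le_one) (right_mem_Icc.2 zero_le_one) ht
  have hρ : 0 ≤ ρ := (norm_nonneg _).trans h0.le
  refine lt_of_pow_lt_pow_left₀ 2 hρ (this.trans_lt (max_lt ?_ ?_)) <;> gcongr

/-- The velocity of the curve with end points `p`, `q` and acceleration `a`. -/
def velocityOfAcc (p q : E) (a : ℝ → E) (t : ℝ) : E :=
  (q - p) + ((∫ s in (0 : ℝ)..t, a s) - ∫ u in (0 : ℝ)..1, ∫ s in (0 : ℝ)..u, a s)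

/-- The curve with end points `p`, `q` and acceleration `a`. -/
def curveOfAcc (p q : E) (a : ℝ → E) (t : ℝ) : E :=
  p + ∫ s in (0 : ℝ)..t, velocityOfAcc p q a s

variable {p q : E} {a : ℝ → E}

theorem curveOfAcc_zero : curveOfAcc p q a 0 = p := by simp [curveOfAcc]

theorem norm_integral_acc_le {m : ℝ} (ha : ∀ t, ‖a t‖ ≤ m) {t : ℝ} (ht : t ∈ Icc (0 : ℝ) 1) :
    ‖∫ s in (0 : ℝ)..t, a s‖ ≤ m := by
  have hm : 0 ≤ m := (norm_nonneg _).trans (ha 0)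
  refine (norm_integral_le_of_norm_le_const fun s _ ↦ ha s).trans ?_
  rw [sub_zero, abs_of_nonneg ht.1]
  exact mul_le_of_le_one_right hm ht.2

theorem norm_integral_integral_acc_le {m : ℝ} (ha : ∀ t, ‖a t‖ ≤ m) :
    ‖∫ u in (0 : ℝ)..1, ∫ s in (0 : ℝ)..u, a s‖ ≤ m := by
  refine (intervalIntegral.norm_integral_le_of_norm_le_const (C := m) fun s hs ↦ ?_).trans (by simp)
  rw [uIoc_of_le zero_le_one] at hs
  exact norm_integral_acc_le ha (Ioc_subset_Icc_self hs)

theorem norm_velocityOfAcc_le {m : ℝ} (ha : ∀ t, ‖a t‖ ≤ m) {t : ℝ} (ht : t ∈ Icc (0 : ℝ) 1) :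
    ‖velocityOfAcc p q a t‖ ≤ ‖q - p‖ + 2 * m := by
  refine (norm_add_le _ _).trans ?_
  gcongr
  refine (norm_sub_le _ _).trans ?_
  linarith [norm_integral_acc_le ha ht, norm_integral_integral_acc_le ha]

theorem velocityOfAcc_sub {b : ℝ → E} (ha : Continuous a) (hb : Continuous b) (t : ℝ) :
    velocityOfAcc p q a t - velocityOfAcc p q b t = velocityOfAcc 0 0 (fun s ↦ a s - b s) t := by
  have hi : ∀ {a : ℝ → E}, Continuous a → Continuous fun u : ℝ ↦ ∫ s in (0 : ℝ)..u, a s :=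
    fun ha ↦ intervalIntegral.continuous_primitive (fun _ _ ↦ ha.intervalIntegrable _ _) 0
  have h : ∀ u, ∫ s in (0 : ℝ)..u, a s - b s
      = (∫ s in (0 : ℝ)..u, a s) - ∫ s in (0 : ℝ)..u, b s := fun u ↦
    intervalIntegral.integral_sub (ha.intervalIntegrable _ _) (hb.intervalIntegrable _ _)
  simp only [velocityOfAcc, h]
  rw [intervalIntegral.integral_sub ((hi ha).intervalIntegrable _ _)
    ((hi hb).intervalIntegrable _ _)]
  abel

theorem norm_velocityOfAcc_sub_le {b : ℝ → E} (ha : Continuous a) (hb : Continuous b) {m : ℝ}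
    (hab : ∀ t, ‖a t - b t‖ ≤ m) {t : ℝ} (ht : t ∈ Icc (0 : ℝ) 1) :
    ‖velocityOfAcc p q a t - velocityOfAcc p q b t‖ ≤ 2 * m := by
  rw [velocityOfAcc_sub ha hb]
  simpa using norm_velocityOfAcc_le (p := 0) (q := 0) hab ht

variable [CompleteSpace E]

theorem hasDerivAt_velocityOfAcc (ha : Continuous a) (t : ℝ) :
    HasDerivAt (velocityOfAcc p q a) (a t) t :=
  ((integral_hasDerivAt_right (ha.intervalIntegrable _ _)
    ha.stronglyMeasurable.stronglyMeasurableAtFilter ha.continuousAt).sub_const _).const_add _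

theorem continuous_velocityOfAcc (ha : Continuous a) : Continuous (velocityOfAcc p q a) :=
  continuous_iff_continuousAt.2 fun t ↦ (hasDerivAt_velocityOfAcc ha t).continuousAt

theorem hasDerivAt_curveOfAcc (ha : Continuous a) (t : ℝ) :
    HasDerivAt (curveOfAcc p q a) (velocityOfAcc p q a t) t :=
  (integral_hasDerivAt_right ((continuous_velocityOfAcc ha).intervalIntegrable _ _)
    (continuous_velocityOfAcc ha).stronglyMeasurable.stronglyMeasurableAtFilter
    (continuous_velocityOfAcc ha).continuousAt).const_add _

theorem continuous_curveOfAcc (ha : Continuous a) : Continuous (curveOfAcc p q a) :=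
  continuous_iff_continuousAt.2 fun t ↦ (hasDerivAt_curveOfAcc ha t).continuousAt

/-- The constant subtracted in `velocityOfAcc` is the mean over `[0, 1]` of the primitive of `a`,
which cancels the displacement that `a` causes. -/
theorem curveOfAcc_one (ha : Continuous a) : curveOfAcc p q a 1 = q := by
  have hi : Continuous fun u : ℝ ↦ ∫ s in (0 : ℝ)..u, a s :=
    intervalIntegral.continuous_primitive (fun _ _ ↦ ha.intervalIntegrable _ _) 0
  simp only [curveOfAcc, velocityOfAcc]
  rw [intervalIntegral.integral_add (f := fun _ ↦ q - p)
      (g := fun t ↦ (∫ s in (0 : ℝ)..t, a s) - ∫ u in (0 : ℝ)..1, ∫ s in (0 : ℝ)..u, a s)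
      (by simp) ((hi.sub continuous_const).intervalIntegrable _ _),
    intervalIntegral.integral_sub (hi.intervalIntegrable _ _) (by simp)]
  simp

theorem norm_curveOfAcc_sub_le {b : ℝ → E} (ha : Continuous a) (hb : Continuous b) {m : ℝ}
    (hab : ∀ t, ‖a t - b t‖ ≤ m) {t : ℝ} (ht : t ∈ Icc (0 : ℝ) 1) :
    ‖curveOfAcc p q a t - curveOfAcc p q b t‖ ≤ 2 * m := by
  have hm : 0 ≤ m := (norm_nonneg _).trans (hab 0)
  have := (convex_Icc (0 : ℝ) 1).norm_image_sub_le_of_norm_hasDerivWithin_le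
    (fun t _ ↦ ((hasDerivAt_curveOfAcc (p := p) (q := q) ha t).sub
      (hasDerivAt_curveOfAcc (p := p) (q := q) hb t)).hasDerivWithinAt)
    (fun t ht ↦ norm_velocityOfAcc_sub_le ha hb hab ht) (left_mem_Icc.2 zero_le_one) ht
  simp only [Pi.sub_apply, curveOfAcc_zero, sub_self, sub_zero, Real.norm_eq_abs,
    abs_of_nonneg ht.1] at this
  exact this.trans (mul_le_of_le_one_right (by positivity) ht.2)

/-- Nearby points are joined by a geodesic. -/
theorem exists_isSprayCurve {B : E → E →L[ℝ] E →L[ℝ] E} {C : ℝ} (hB : ∀ y, ‖B y‖ ≤ C)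
    (hL : ∀ y z, ‖B y - B z‖ ≤ C * ‖y - z‖) {d : ℝ} (hd : ‖q - p‖ ≤ d) (h9 : 9 * C * d ≤ 1)
    (hd' : 9 * C * d ^ 2 + 6 * C * d ≤ 1 / 4) :
    ∃ x v : ℝ → E, IsSprayCurve B x v ∧ x 0 = p ∧ x 1 = q ∧
      ∀ t ∈ Icc (0 : ℝ) 1, ‖v t‖ ≤ 3 * d := by
  have hC : 0 ≤ C := (norm_nonneg (B 0)).trans (hB 0)
  have hd0 : 0 ≤ d := (norm_nonneg _).trans hd
  have hBc : Continuous B := continuous_of_norm_sub_le hC hL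
  -- Clamping time to `[0, 1]` allows the use of bounded continuous functions on `ℝ`, a complete
  -- space, as the space of accelerations.
  set π : ℝ → ℝ := fun t ↦ (projIcc (0 : ℝ) 1 zero_le_one t : ℝ) with hπ
  have hπc : Continuous π := continuous_subtype_val.comp continuous_projIcc
  have hπm : ∀ t, π t ∈ Icc (0 : ℝ) 1 := fun t ↦ Subtype.coe_prop _
  have hπi : ∀ t ∈ Icc (0 : ℝ) 1, π t = t := fun t ht ↦ by simp [hπ, projIcc_of_mem _ ht]
  have hvb : ∀ a : ℝ →ᵇ E, ∀ t, ‖velocityOfAcc p q a (π t)‖ ≤ d + 2 * ‖a‖ := fun a t ↦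
    (norm_velocityOfAcc_le a.norm_coe_le_norm (hπm t)).trans (by gcongr)
  -- A fixed point is an acceleration that equals `B(x)(x', x')` along the curve which it generates.
  -- The end points are built into that curve.
  let Φ : (ℝ →ᵇ E) → (ℝ →ᵇ E) := fun a ↦ BoundedContinuousFunction.ofNormedAddCommGroup
    (fun t ↦ B (curveOfAcc p q a (π t)) (velocityOfAcc p q a (π t)) (velocityOfAcc p q a (π t)))
    (((hBc.comp ((continuous_curveOfAcc a.continuous).comp hπc)).clm_apply
      ((continuous_velocityOfAcc a.continuous).comp hπc)).clm_apply
      ((continuous_velocityOfAcc a.continuous).comp hπc))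
    (C * (d + 2 * ‖a‖) ^ 2) (fun t ↦ norm_quadratic_le hB _ _ (hvb a t))
  have hΦ : ∀ a t, Φ a t = B (curveOfAcc p q a (π t)) (velocityOfAcc p q a (π t))
    (velocityOfAcc p q a (π t)) := fun a t ↦ rfl
  have hvs : ∀ a ∈ Metric.closedBall (0 : ℝ →ᵇ E) d, ∀ t, ‖velocityOfAcc p q a (π t)‖ ≤ 3 * d := by
    intro a ha t
    rw [mem_closedBall_zero_iff] at ha
    linarith [hvb a t]
  have hmaps : MapsTo Φ (Metric.closedBall 0 d) (Metric.closedBall 0 d) := by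
    intro a ha
    rw [mem_closedBall_zero_iff, BoundedContinuousFunction.norm_le hd0]
    intro t
    rw [hΦ]
    refine (norm_quadratic_le hB _ _ (hvs a ha t)).trans ?_
    calc C * (3 * d) ^ 2 = (9 * C * d) * d := by ring
      _ ≤ 1 * d := by gcongr
      _ = d := one_mul d
  have hcontr : ContractingWith (1 / 2) (hmaps.restrict Φ _ _) := by
    refine ⟨by rw [← NNReal.coe_lt_coe]; norm_num, LipschitzWith.of_dist_le_mul fun a b ↦ ?_⟩
    rw [Subtype.dist_eq, Subtype.dist_eq, MapsTo.val_restrict_apply, MapsTo.val_restrict_apply]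
    obtain ⟨a, ha⟩ := a
    obtain ⟨b, hb⟩ := b
    rw [BoundedContinuousFunction.dist_le (by positivity)]
    intro t
    have hab : ∀ t, ‖a t - b t‖ ≤ dist a b := fun t ↦ by
      rw [← dist_eq_norm]; exact BoundedContinuousFunction.dist_coe_le_dist t
    rw [dist_eq_norm, hΦ, hΦ]
    refine (norm_quadratic_sub_le hB hL (hvs a ha t) (hvs b hb t)).trans ?_
    have h1 := norm_curveOfAcc_sub_le (p := p) (q := q) a.continuous b.continuous hab (hπm t)
    have h2 := norm_velocityOfAcc_sub_le (p := p) (q := q) a.continuous b.continuous hab (hπm t)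
    calc _ ≤ C * (3 * d) ^ 2 * (2 * dist a b) + 2 * C * (3 * d) * (2 * dist a b) := by gcongr
      _ = (9 * C * d ^ 2 + 6 * C * d) * (2 * dist a b) := by ring
      _ ≤ 1 / 4 * (2 * dist a b) := by gcongr
      _ = _ := by push_cast; ring
  obtain ⟨a, ha, hfix, -⟩ := hcontr.exists_fixedPoint' Metric.isClosed_closedBall.isComplete hmaps
    (Metric.mem_closedBall_self hd0) (edist_ne_top _ _)
  refine ⟨curveOfAcc p q a, velocityOfAcc p q a, ⟨fun t _ ↦
    (hasDerivAt_curveOfAcc a.continuous t).hasDerivWithinAt, fun t ht ↦ ?_⟩, curveOfAcc_zero,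
    curveOfAcc_one a.continuous, fun t ht ↦ by simpa only [hπi t ht] using hvs a ha t⟩
  have h1 : a t = B (curveOfAcc p q a t) (velocityOfAcc p q a t) (velocityOfAcc p q a t) := by
    conv_lhs => rw [← hfix.eq]
    rw [hΦ, hπi t ht]
  rw [← h1]
  exact (hasDerivAt_velocityOfAcc a.continuous t).hasDerivWithinAt

/-- Small balls are geodesically convex. -/
theorem exists_isSprayCurve_mem_ball {B : E → E →L[ℝ] E →L[ℝ] E} {C r : ℝ} (hB : ∀ y, ‖B y‖ ≤ C)
    (hL : ∀ y z, ‖B y - B z‖ ≤ C * ‖y - z‖) (hC : 1 ≤ C) (hr : 100 * C * r ≤ 1) {y₀ : E}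
    (hp : p ∈ Metric.ball y₀ r) (hq : q ∈ Metric.ball y₀ r) :
    ∃ x v : ℝ → E, IsSprayCurve B x v ∧ x 0 = p ∧ x 1 = q ∧
      ∀ t ∈ Icc (0 : ℝ) 1, x t ∈ Metric.ball y₀ r := by
  have hr0 : 0 < r := Metric.pos_of_mem_ball hp
  have hCr : 0 < C * r := by positivity
  have hr1 : r ≤ 1 / 100 := by nlinarith
  rw [mem_ball_iff_norm] at hp hq
  have hqp : ‖q - p‖ ≤ 2 * r := by
    have := norm_sub_le (q - y₀) (p - y₀)
    rw [sub_sub_sub_cancel_right] at this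
    linarith
  -- The bound is applied with `d = 2 * r`. Speeds are then at most `6 * r`, so the curve stays
  -- within `7 * r` of the center. This crude bound is enough for the convexity argument, which
  -- improves it to `r`.
  obtain ⟨x, v, h, h0, h1, hv⟩ := exists_isSprayCurve hB hL hqp (by linarith) (by nlinarith)
  refine ⟨x, v, h, h0, h1, ?_⟩
  simp only [mem_ball_iff_norm]
  refine h.norm_sub_le hB (fun t ht ↦ ?_) (h0 ▸ hp) (h1 ▸ hq)
  have h2 : ‖x t - x 0‖ ≤ 6 * r := by
    refine ((convex_Icc (0 : ℝ) 1).norm_image_sub_le_of_norm_hasDerivWithin_le h.hasDeriv hv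
      (left_mem_Icc.2 zero_le_one) ht).trans ?_
    rw [sub_zero, Real.norm_eq_abs, abs_of_nonneg ht.1]
    nlinarith [ht.2]
  have h3 : ‖x t - y₀‖ ≤ 7 * r := by
    have := norm_add_le (x t - x 0) (p - y₀)
    rw [h0, sub_add_sub_cancel] at this
    rw [h0] at h2
    linarith
  nlinarith

end SprayExistence

/-! ### Small Lorentz balls, first variation and the Gauss lemma -/

section LocalLorentzGeometry

set_option maxSynthPendingDepth 3

open Filter

variable {n : ℕ} {E : Type*} [NormedAddCommGroup E] [InnerProductSpace ℝ E]

/-- A Lorentzian metric `G` on a ball which is so small that the geodesic equation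
`x'' = B(x)(x', x')` is under control. -/
structure IsSmallLorentzBall (n : ℕ) (G : E → E →L[ℝ] E →L[ℝ] ℝ) (B : E → E →L[ℝ] E →L[ℝ] E)
    (C K r : ℝ) (y₀ : E) : Prop where
  lorentz : ∀ y ∈ Metric.ball y₀ r, IsLorentzForm n (G y)
  differentiableAt : ∀ y ∈ Metric.ball y₀ r, DifferentiableAt ℝ G y
  taylor : ∀ y ∈ Metric.ball y₀ r, ∀ z ∈ Metric.ball y₀ r,
    ‖G z - G y - fderiv ℝ G y (z - y)‖ ≤ K * ‖z - y‖ ^ 2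
  norm_le : ∀ y ∈ Metric.ball y₀ r, ‖G y‖ ≤ K
  norm_fderiv_le : ∀ y ∈ Metric.ball y₀ r, ‖fderiv ℝ G y‖ ≤ K
  spray : ∀ y ∈ Metric.ball y₀ r, ∀ v w,
    G y (B y v v) w = fderiv ℝ G y w v v / 2 - fderiv ℝ G y v v w
  bound : ∀ y, ‖B y‖ ≤ C
  lipschitz : ∀ y z, ‖B y - B z‖ ≤ C * ‖y - z‖
  one_le : 1 ≤ C
  radius_pos : 0 < r
  radius_le : 100 * C * r ≤ 1

/-- A choice of geodesics `x q : [0, 1] → E` with velocity `v q` from `p` to the points `q` of a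
ball. -/
structure IsGeodesicFan (B : E → E →L[ℝ] E →L[ℝ] E) (y₀ : E) (r : ℝ) (p : E)
    (x v : E → ℝ → E) : Prop where
  isSprayCurve : ∀ q ∈ Metric.ball y₀ r, IsSprayCurve B (x q) (v q)
  source : ∀ q ∈ Metric.ball y₀ r, x q 0 = p
  target : ∀ q ∈ Metric.ball y₀ r, x q 1 = q
  mem : ∀ q ∈ Metric.ball y₀ r, ∀ t ∈ Icc (0 : ℝ) 1, x q t ∈ Metric.ball y₀ r

variable {G : E → E →L[ℝ] E →L[ℝ] ℝ} {B : E → E →L[ℝ] E →L[ℝ] E} {C K r : ℝ} {y₀ p q : E}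

namespace IsSmallLorentzBall

theorem exists_fan [CompleteSpace E] (hb : IsSmallLorentzBall n G B C K r y₀)
    (hp : p ∈ Metric.ball y₀ r) : ∃ x v : E → ℝ → E, IsGeodesicFan B y₀ r p x v := by
  have := fun q (hq : q ∈ Metric.ball y₀ r) ↦
    exists_isSprayCurve_mem_ball hb.bound hb.lipschitz hb.one_le hb.radius_le hp hq
  choose! x v h using this
  exact ⟨x, v, fun q hq ↦ (h q hq).1, fun q hq ↦ (h q hq).2.1, fun q hq ↦ (h q hq).2.2.1,
    fun q hq ↦ (h q hq).2.2.2⟩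

theorem radius_le' (hb : IsSmallLorentzBall n G B C K r y₀) : r ≤ 1 / 100 := by
  nlinarith [hb.one_le, hb.radius_le, hb.radius_pos]

/-- The smallness condition of `IsSprayCurve.norm_vel_sub_le` for `S = 8 * r`, the speed bound valid
for geodesics in the ball. -/
theorem slow (hb : IsSmallLorentzBall n G B C K r y₀) :
    C * (8 * r) ^ 2 + 2 * C * (8 * r) ≤ 1 / 2 := by
  have h1 := hb.radius_le
  have h2 := hb.radius_le'
  have h3 := hb.radius_pos
  have h4 := hb.one_le
  have h5 : C * r * r ≤ C * r * (1 / 100) := by gcongr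
  nlinarith

theorem speed_le (hb : IsSmallLorentzBall n G B C K r y₀) {x v : ℝ → E} (h : IsSprayCurve B x v)
    (hx : ∀ t ∈ Icc (0 : ℝ) 1, x t ∈ Metric.ball y₀ r) :
    ∀ t ∈ Icc (0 : ℝ) 1, ‖v t‖ ≤ 8 * r :=
  h.speed_le hb.bound (by linarith [hb.one_le]) hx (by nlinarith [hb.radius_le, hb.one_le, hb.radius_pos])

theorem norm_vel_sub_le (hb : IsSmallLorentzBall n G B C K r y₀) {x v y w : ℝ → E}
    (hxv : IsSprayCurve B x v) (hx : ∀ t ∈ Icc (0 : ℝ) 1, x t ∈ Metric.ball y₀ r)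
    (hyw : IsSprayCurve B y w) (hy : ∀ t ∈ Icc (0 : ℝ) 1, y t ∈ Metric.ball y₀ r)
    (h0 : x 0 = y 0) :
    ∀ t ∈ Icc (0 : ℝ) 1, ‖w t - v t‖ ≤ 2 * ‖y 1 - x 1‖ ∧ ‖y t - x t‖ ≤ 2 * ‖y 1 - x 1‖ :=
  hxv.norm_vel_sub_le hyw hb.bound hb.lipschitz (hb.speed_le hxv hx) (hb.speed_le hyw hy) hb.slow h0

/-- Geodesics inside a small ball are determined by their end points. -/
theorem unique (hb : IsSmallLorentzBall n G B C K r y₀) {x v y w : ℝ → E}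
    (hxv : IsSprayCurve B x v) (hx : ∀ t ∈ Icc (0 : ℝ) 1, x t ∈ Metric.ball y₀ r)
    (hyw : IsSprayCurve B y w) (hy : ∀ t ∈ Icc (0 : ℝ) 1, y t ∈ Metric.ball y₀ r)
    (h0 : x 0 = y 0) (h1 : x 1 = y 1) : ∀ t ∈ Icc (0 : ℝ) 1, w t = v t ∧ y t = x t := by
  intro t ht
  have := hb.norm_vel_sub_le hxv hx hyw hy h0 t ht
  simpa [h1, sub_eq_zero] using this

theorem hasDerivWithinAt_metric (hb : IsSmallLorentzBall n G B C K r y₀) {x : ℝ → E} {v : E}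
    {s : Set ℝ} {t : ℝ} (h : HasDerivWithinAt x v s t) (hx : x t ∈ Metric.ball y₀ r) :
    HasDerivWithinAt (fun t ↦ G (x t)) (fderiv ℝ G (x t) v) s t :=
  (hb.differentiableAt _ hx).hasFDerivAt.comp_hasDerivWithinAt t h

/-- The speed of a geodesic is constant. -/
theorem energy_const (hb : IsSmallLorentzBall n G B C K r y₀) {x v : ℝ → E}
    (h : IsSprayCurve B x v) (hx : ∀ t ∈ Icc (0 : ℝ) 1, x t ∈ Metric.ball y₀ r) :
    ∀ t ∈ Icc (0 : ℝ) 1, G (x t) (v t) (v t) = G (x 1) (v 1) (v 1) := by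
  intro t ht
  have hd : ∀ t ∈ Icc (0 : ℝ) 1,
      HasDerivWithinAt (fun t ↦ G (x t) (v t) (v t)) 0 (Icc 0 1) t := fun t ht ↦ by
    have h1 := ((hb.hasDerivWithinAt_metric (h.hasDeriv t ht) (hx t ht)).clm_apply
      (h.hasDeriv_vel t ht)).clm_apply (h.hasDeriv_vel t ht)
    refine h1.congr_deriv ?_
    rw [add_apply, (hb.lorentz _ (hx t ht)).symm (v t), hb.spray _ (hx t ht)]
    ring
  have := (convex_Icc (0 : ℝ) 1).norm_image_sub_le_of_norm_hasDerivWithin_le hd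
    (fun t _ ↦ norm_zero.le) (right_mem_Icc.2 zero_le_one) ht
  rwa [zero_mul, norm_le_zero_iff, sub_eq_zero] at this

/-- The first variation of the energy. -/
theorem first_variation (hb : IsSmallLorentzBall n G B C K r y₀) {x v y w : ℝ → E}
    (hxv : IsSprayCurve B x v) (hx : ∀ t ∈ Icc (0 : ℝ) 1, x t ∈ Metric.ball y₀ r)
    (hyw : IsSprayCurve B y w) (hy : ∀ t ∈ Icc (0 : ℝ) 1, y t ∈ Metric.ball y₀ r)
    (h0 : x 0 = y 0) :
    ‖G (y 1) (w 1) (w 1) - G (x 1) (v 1) (v 1) - 2 * G (x 1) (v 1) (y 1 - x 1)‖ ≤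
      16 * K * ‖y 1 - x 1‖ ^ 2 := by
  set ε := ‖y 1 - x 1‖ with hε
  have hK : 0 ≤ K := (norm_nonneg (G (x 0))).trans (hb.norm_le _ (hx 0 (left_mem_Icc.2 zero_le_one)))
  set c := G (y 1) (w 1) (w 1) - G (x 1) (v 1) (v 1) with hc
  -- Both energies are constant, so `c` is also their difference at every time `t`. The geodesic
  -- equation for `x` turns the derivative of `2 G(v, y - x)` into the linear part of that
  -- difference. Only a remainder quadratic in `(y - x, w - v)` is left, and at time 0 the function
  -- vanishes.
  have hd : ∀ t ∈ Icc (0 : ℝ) 1,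
      HasDerivWithinAt (fun t ↦ t * c - 2 * G (x t) (v t) (y t - x t))
        (c - (fderiv ℝ G (x t) (y t - x t) (v t) (v t) + 2 * G (x t) (v t) (w t - v t)))
        (Icc 0 1) t := fun t ht ↦ by
    have h1 := (((hb.hasDerivWithinAt_metric (hxv.hasDeriv t ht) (hx t ht)).clm_apply
      (hxv.hasDeriv_vel t ht)).clm_apply ((hyw.hasDeriv t ht).sub (hxv.hasDeriv t ht))).const_mul 2
    have h2 := ((hasDerivWithinAt_id t (Icc (0 : ℝ) 1)).mul_const c).sub h1
    refine h2.congr_deriv ?_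
    simp only [add_apply, hb.spray _ (hx t ht), Pi.sub_apply]
    ring
  have hbd : ∀ t ∈ Icc (0 : ℝ) 1,
      ‖c - (fderiv ℝ G (x t) (y t - x t) (v t) (v t) + 2 * G (x t) (v t) (w t - v t))‖
        ≤ 16 * K * ε ^ 2 := fun t ht ↦ by
    obtain ⟨hwv, hyx⟩ := hb.norm_vel_sub_le hxv hx hyw hy h0 t ht
    have hr := hb.radius_le'
    have hv1 : ‖v t‖ ≤ 1 / 2 := (hb.speed_le hxv hx t ht).trans (by linarith)
    have hw1 : ‖w t‖ ≤ 1 / 2 := (hb.speed_le hyw hy t ht).trans (by linarith)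
    rw [← hε] at hwv hyx
    have hε0 : 0 ≤ ε := norm_nonneg _
    -- Second-order expansion of `G(y)(w, w)` at `(x, v)`. The four terms are at most `1`, `2`, `2`
    -- and `4` times `K * ε ^ 2`.
    have e : c - (fderiv ℝ G (x t) (y t - x t) (v t) (v t) + 2 * G (x t) (v t) (w t - v t))
        = (G (y t) - G (x t) - fderiv ℝ G (x t) (y t - x t)) (w t) (w t)
          + fderiv ℝ G (x t) (y t - x t) (w t - v t) (w t)
          + fderiv ℝ G (x t) (y t - x t) (v t) (w t - v t)
          + G (x t) (w t - v t) (w t - v t) := by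
      rw [hc, ← hb.energy_const hxv hx t ht, ← hb.energy_const hyw hy t ht]
      simp only [sub_apply, map_sub, (hb.lorentz _ (hx t ht)).symm (w t) (v t)]
      ring
    rw [e]
    have b1 : ‖(G (y t) - G (x t) - fderiv ℝ G (x t) (y t - x t)) (w t) (w t)‖
        ≤ K * (2 * ε) ^ 2 * (1 / 2) * (1 / 2) :=
      (ContinuousLinearMap.le_opNorm₂ _ _ _).trans (by
        gcongr
        exact (hb.taylor _ (hx t ht) _ (hy t ht)).trans (by gcongr))
    have hDz : ‖fderiv ℝ G (x t) (y t - x t)‖ ≤ K * (2 * ε) :=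
      (ContinuousLinearMap.le_opNorm _ _).trans (by
        gcongr; exact hb.norm_fderiv_le _ (hx t ht))
    have b2 : ‖fderiv ℝ G (x t) (y t - x t) (w t - v t) (w t)‖ ≤ K * (2 * ε) * (2 * ε) * (1 / 2) :=
      (ContinuousLinearMap.le_opNorm₂ _ _ _).trans (by gcongr)
    have b3 : ‖fderiv ℝ G (x t) (y t - x t) (v t) (w t - v t)‖ ≤ K * (2 * ε) * (1 / 2) * (2 * ε) :=
      (ContinuousLinearMap.le_opNorm₂ _ _ _).trans (by gcongr)
    have b4 : ‖G (x t) (w t - v t) (w t - v t)‖ ≤ K * (2 * ε) * (2 * ε) :=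
      (ContinuousLinearMap.le_opNorm₂ _ _ _).trans (by gcongr; exact hb.norm_le _ (hx t ht))
    have hKε : 0 ≤ K * ε ^ 2 := by positivity
    refine norm_add₄_le.trans ?_
    nlinarith
  have := (convex_Icc (0 : ℝ) 1).norm_image_sub_le_of_norm_hasDerivWithin_le hd hbd
    (left_mem_Icc.2 zero_le_one) (right_mem_Icc.2 zero_le_one)
  simpa [h0] using this

end IsSmallLorentzBall

namespace IsGeodesicFan

variable {x v : E → ℝ → E}

/-- Uniqueness shows that the choice in a fan is no choice: every geodesic in the ball from `p`
belongs to it. -/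
theorem eq_of_isSprayCurve (hf : IsGeodesicFan B y₀ r p x v)
    (hb : IsSmallLorentzBall n G B C K r y₀) {y w : ℝ → E} (hyw : IsSprayCurve B y w)
    (hy : ∀ t ∈ Icc (0 : ℝ) 1, y t ∈ Metric.ball y₀ r) (h0 : y 0 = p) :
    ∀ t ∈ Icc (0 : ℝ) 1, w t = v (y 1) t ∧ y t = x (y 1) t := by
  have hq := hy 1 (right_mem_Icc.2 zero_le_one)
  exact hb.unique (hf.isSprayCurve _ hq) (hf.mem _ hq) hyw hy ((hf.source _ hq).trans h0.symm)
    (hf.target _ hq)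

/-- The final velocities along a geodesic from the vertex of a fan. -/
theorem endVel_apply (hf : IsGeodesicFan B y₀ r p x v) (hb : IsSmallLorentzBall n G B C K r y₀)
    (hq : q ∈ Metric.ball y₀ r) {s : ℝ} (hs : s ∈ Icc (0 : ℝ) 1) :
    v (x q s) 1 = s • v q s := by
  -- The piece of the geodesic up to time `s`, stretched to `[0, 1]`, is the fan geodesic to `x q
  -- s`.
  have := (hf.eq_of_isSprayCurve hb ((hf.isSprayCurve q hq).rescale hs)
    (fun t ht ↦ hf.mem q hq _ ⟨mul_nonneg hs.1 ht.1, mul_le_one₀ hs.2 ht.1 ht.2⟩)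
    (by simpa using hf.source q hq) 1 (right_mem_Icc.2 zero_le_one)).1
  simpa using this.symm

theorem norm_endVel_sub_le (hf : IsGeodesicFan B y₀ r p x v)
    (hb : IsSmallLorentzBall n G B C K r y₀) {q q' : E} (hq : q ∈ Metric.ball y₀ r)
    (hq' : q' ∈ Metric.ball y₀ r) : ‖v q' 1 - v q 1‖ ≤ 2 * ‖q' - q‖ := by
  have := (hb.norm_vel_sub_le (hf.isSprayCurve q hq) (hf.mem q hq) (hf.isSprayCurve q' hq')
    (hf.mem q' hq') ((hf.source q hq).trans (hf.source q' hq').symm) 1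
    (right_mem_Icc.2 zero_le_one)).1
  rwa [hf.target q hq, hf.target q' hq'] at this

theorem norm_endVel_sub_sub_le (hf : IsGeodesicFan B y₀ r p x v)
    (hb : IsSmallLorentzBall n G B C K r y₀) (hq : q ∈ Metric.ball y₀ r) :
    ‖v q 1 - (q - p)‖ ≤ 4 * C * ‖q - p‖ ^ 2 := by
  have := (hf.isSprayCurve q hq).norm_vel_sub_sub_le hb.bound hb.lipschitz
    (hb.speed_le (hf.isSprayCurve q hq) (hf.mem q hq)) hb.slow
  rwa [hf.target q hq, hf.source q hq] at this

/-- Supplies the Lipschitz condition for ODE uniqueness in the equality case. -/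
theorem lipschitzOnWith_endVel (hf : IsGeodesicFan B y₀ r p x v)
    (hb : IsSmallLorentzBall n G B C K r y₀) :
    LipschitzOnWith 2 (fun q ↦ v q 1) (Metric.ball y₀ r) :=
  LipschitzOnWith.of_dist_le_mul fun q hq q' hq' ↦ by
    rw [dist_eq_norm, dist_eq_norm]
    exact hf.norm_endVel_sub_le hb hq' hq

/-- The gradient of the energy function (the Gauss lemma). -/
theorem hasFDerivAt_energy (hf : IsGeodesicFan B y₀ r p x v)
    (hb : IsSmallLorentzBall n G B C K r y₀) (hq : q ∈ Metric.ball y₀ r) :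
    HasFDerivAt (fun q ↦ G q (v q 1) (v q 1)) ((2 : ℝ) • G q (v q 1)) q := by
  -- The quadratic remainder in the first variation is already differentiability of the energy, so
  -- the final velocity itself need not be differentiated.
  have hO : (fun q' ↦ G q' (v q' 1) (v q' 1) - G q (v q 1) (v q 1)
      - ((2 : ℝ) • G q (v q 1)) (q' - q)) =O[𝓝 q] fun q' ↦ ‖q' - q‖ ^ 2 := by
    refine Asymptotics.IsBigO.of_bound (16 * K) ?_
    filter_upwards [Metric.isOpen_ball.mem_nhds hq] with q' hq'
    have := hb.first_variation (hf.isSprayCurve q hq) (hf.mem q hq) (hf.isSprayCurve q' hq')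
      (hf.mem q' hq') ((hf.source q hq).trans (hf.source q' hq').symm)
    rw [hf.target q hq, hf.target q' hq'] at this
    simpa using this
  rw [hasFDerivAt_iff_isLittleO]
  exact hO.trans_isLittleO ((Asymptotics.isLittleO_norm_pow_id one_lt_two).comp_tendsto
    (tendsto_sub_nhds_zero_iff.2 tendsto_id) |>.congr_left (fun _ ↦ rfl))

end IsGeodesicFan

end LocalLorentzGeometry

/-! ### The twin paradox in a small ball -/

section LocalTwinParadox

set_option maxSynthPendingDepth 3

open Filter

/-- If `N` decreases where `h < 0`, and `h` can only change sign where `N ≥ 0`, then `N` and `h`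
stay negative. -/
theorem neg_of_eventually_neg {N h : ℝ → ℝ} {a b : ℝ}
    (hN : ∀ t ∈ Icc a b, HasDerivWithinAt N (2 * h t) (Icc a b) t) (hh : ContinuousOn h (Icc a b))
    (hne : ∀ t ∈ Ioc a b, N t < 0 → h t ≠ 0) (hev : ∀ᶠ t in 𝓝[>] a, N t < 0 ∧ h t < 0) :
    ∀ t ∈ Ioc a b, N t < 0 ∧ h t < 0 := by
  intro t₁ ht₁
  obtain ⟨c, ⟨hNc, hhc⟩, hac, hct⟩ := (hev.and (Ioo_mem_nhdsGT ht₁.1)).exists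
  have hsub : Icc c t₁ ⊆ Icc a b := Icc_subset_Icc hac.le ht₁.2
  have hanti : ∀ z ∈ Icc c t₁, (∀ t ∈ Ioo c z, h t < 0) → N z ≤ N c := by
    intro z hz hneg
    have hsz : Icc c z ⊆ Icc a b := (Icc_subset_Icc_right hz.2).trans hsub
    refine antitoneOn_of_hasDerivWithinAt_nonpos (convex_Icc c z) (f' := fun t ↦ 2 * h t)
      (fun t ht ↦ (hN t (hsz ht)).continuousWithinAt.mono hsz)
      (fun t ht ↦ (hN t (hsz (interior_subset ht))).mono (interior_subset.trans hsz))
      (fun t ht ↦ ?_) (left_mem_Icc.2 hz.1) (right_mem_Icc.2 hz.1) hz.1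
    rw [interior_Icc] at ht
    linarith [hneg t ht]
  have key : ∀ t ∈ Icc c t₁, h t < 0 := by
    by_contra! hex
    have hcpt : IsCompact (Icc c t₁ ∩ h ⁻¹' Ici 0) :=
      isCompact_Icc.of_isClosed_subset
        ((hh.mono hsub).preimage_isClosed_of_isClosed isClosed_Icc isClosed_Ici) inter_subset_left
    obtain ⟨z, ⟨hz, hhz⟩, hmin⟩ := hcpt.exists_isLeast hex
    -- Here `z` is the first time with `h ≥ 0`. Before `z` the function `N` decreases, so `N z < 0`
    -- and `h z ≠ 0`, whereas the intermediate value theorem puts a zero of `h` at `z`.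
    have hneg : ∀ t ∈ Ico c z, h t < 0 := fun t ht ↦ by
      by_contra! hcon
      exact (hmin ⟨⟨ht.1, ht.2.le.trans hz.2⟩, hcon⟩).not_gt ht.2
    have hNz := hanti z hz (fun t ht ↦ hneg t (Ioo_subset_Ico_self ht))
    have hz0 : h z ≠ 0 := hne z ⟨hac.trans_le hz.1, hz.2.trans ht₁.2⟩ (hNz.trans_lt hNc)
    obtain ⟨s, hs, hs0⟩ := intermediate_value_Icc hz.1
      (hh.mono ((Icc_subset_Icc_right hz.2).trans hsub)) ⟨hhc.le, hhz⟩
    rcases hs.2.eq_or_lt with rfl | hlt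
    · exact hz0 hs0
    · exact (hneg s ⟨hs.1, hlt⟩).ne hs0
  have hm : t₁ ∈ Icc c t₁ := right_mem_Icc.2 hct.le
  exact ⟨(hanti t₁ hm fun t ht ↦ key t (Ioo_subset_Icc_self ht)).trans_lt hNc, key t₁ hm⟩

theorem ContinuousOn.hasDerivWithinAt_integral {f : ℝ → ℝ} {a b : ℝ}
    (hf : ContinuousOn f (Icc a b)) {t : ℝ} (ht : t ∈ Icc a b) :
    HasDerivWithinAt (fun t ↦ ∫ s in a..t, f s) (f t) (Icc a b) t := by
  have : Fact (t ∈ Icc a b) := ⟨ht⟩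
  refine intervalIntegral.integral_hasDerivWithinAt_right (s := Icc a b) (t := Icc a b)
    ((hf.mono (Icc_subset_Icc_right ht.2)).intervalIntegrable_of_Icc ht.1) ?_ (hf t ht)
  exact hf.stronglyMeasurableAtFilter_nhdsWithin measurableSet_Icc t

variable {n : ℕ} {E : Type*} [NormedAddCommGroup E] [InnerProductSpace ℝ E]

/-- `γ : [a, b] → U` is a `C¹` curve with timelike velocity `γ'`. -/
structure IsTimelikeCurveIn (G : E → E →L[ℝ] E →L[ℝ] ℝ) (U : Set E) (γ γ' : ℝ → E) (a b : ℝ) :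
    Prop where
  lt : a < b
  hasDeriv : ∀ t ∈ Icc a b, HasDerivWithinAt γ (γ' t) (Icc a b) t
  continuousOn_vel : ContinuousOn γ' (Icc a b)
  mem : ∀ t ∈ Icc a b, γ t ∈ U
  timelike : ∀ t ∈ Icc a b, G (γ t) (γ' t) (γ' t) < 0

variable {G : E → E →L[ℝ] E →L[ℝ] ℝ} {B : E → E →L[ℝ] E →L[ℝ] E} {C K r : ℝ} {y₀ p q : E}

theorem IsSmallLorentzBall.continuousOn_metric (hb : IsSmallLorentzBall n G B C K r y₀) :
    ContinuousOn G (Metric.ball y₀ r) := fun y hy ↦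
  (hb.differentiableAt y hy).continuousAt.continuousWithinAt

namespace IsTimelikeCurveIn

variable {γ γ' : ℝ → E} {a b : ℝ} {x v : E → ℝ → E}

theorem continuousOn {U : Set E} (hγ : IsTimelikeCurveIn G U γ γ' a b) :
    ContinuousOn γ (Icc a b) :=
  fun t ht ↦ (hγ.hasDeriv t ht).continuousWithinAt

theorem continuousOn_metric (hb : IsSmallLorentzBall n G B C K r y₀)
    (hγ : IsTimelikeCurveIn G (Metric.ball y₀ r) γ γ' a b) :
    ContinuousOn (fun t ↦ G (γ t)) (Icc a b) :=
  hb.continuousOn_metric.comp hγ.continuousOn hγ.mem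

theorem continuousOn_endVel (hb : IsSmallLorentzBall n G B C K r y₀)
    (hγ : IsTimelikeCurveIn G (Metric.ball y₀ r) γ γ' a b)
    (hf : IsGeodesicFan B y₀ r (γ a) x v) : ContinuousOn (fun t ↦ v (γ t) 1) (Icc a b) :=
  (hf.lipschitzOnWith_endVel hb).continuousOn.comp hγ.continuousOn hγ.mem

theorem _root_.ContinuousLinearMap.tendsto_apply {α F F' : Type*} [NormedAddCommGroup F]
    [NormedSpace ℝ F] [NormedAddCommGroup F'] [NormedSpace ℝ F'] {l : Filter α} {A : α → F →L[ℝ] F'}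
    {A₀ : F →L[ℝ] F'} {u : α → F} {u₀ : F} (hA : Tendsto A l (𝓝 A₀)) (hu : Tendsto u l (𝓝 u₀)) :
    Tendsto (fun t ↦ A t (u t)) l (𝓝 (A₀ u₀)) :=
  (isBoundedBilinearMap_apply.continuous.tendsto (A₀, u₀)).comp (hA.prodMk_nhds hu)

/-- Close to its source, a timelike curve is joined to its source by timelike geodesics. -/
theorem eventually_neg (hb : IsSmallLorentzBall n G B C K r y₀)
    (hγ : IsTimelikeCurveIn G (Metric.ball y₀ r) γ γ' a b)
    (hf : IsGeodesicFan B y₀ r (γ a) x v) :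
    ∀ᶠ t in 𝓝[>] a, G (γ t) (v (γ t) 1) (v (γ t) 1) < 0 ∧ G (γ t) (v (γ t) 1) (γ' t) < 0 := by
  have ha : a ∈ Icc a b := left_mem_Icc.2 hγ.lt.le
  have hle : 𝓝[>] a ≤ 𝓝[Icc a b] a :=
    nhdsWithin_le_of_mem (mem_of_superset (Ioo_mem_nhdsGT hγ.lt) Ioo_subset_Icc_self)
  have hslope : Tendsto (fun t ↦ (t - a)⁻¹ • (γ t - γ a)) (𝓝[>] a) (𝓝 (γ' a)) := by
    have := ((hasDerivWithinAt_iff_tendsto_slope' (s := Ioc a b) (by simp)).1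
      ((hγ.hasDeriv a ha).mono Ioc_subset_Icc_self))
    rw [nhdsWithin_Ioc_eq_nhdsGT hγ.lt] at this
    exact this
  have hγc : Tendsto (fun t ↦ γ t - γ a) (𝓝[>] a) (𝓝 0) := by
    have := ((hγ.continuousOn a ha).mono_left hle).sub_const (γ a)
    rwa [sub_self] at this
  -- The final velocity is `γ t - γ a` up to second order. Divided by `t - a` it therefore tends to
  -- `γ' a`, which is timelike, and division by a positive number preserves the signs in question.
  have hdiff : Tendsto (fun t ↦ (t - a)⁻¹ • (v (γ t) 1 - (γ t - γ a))) (𝓝[>] a) (𝓝 0) := by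
    have hbd : Tendsto (fun t ↦ 4 * C * (‖(t - a)⁻¹ • (γ t - γ a)‖ * ‖γ t - γ a‖)) (𝓝[>] a)
        (𝓝 0) := by
      simpa using (hslope.norm.mul hγc.norm).const_mul (4 * C)
    refine squeeze_zero_norm' ?_ hbd
    filter_upwards [Ioo_mem_nhdsGT hγ.lt, self_mem_nhdsWithin] with t ht hta
    have h1 := hf.norm_endVel_sub_sub_le hb (hγ.mem t (Ioo_subset_Icc_self ht))
    rw [norm_smul, norm_smul]
    calc ‖(t - a)⁻¹‖ * ‖v (γ t) 1 - (γ t - γ a)‖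
        ≤ ‖(t - a)⁻¹‖ * (4 * C * ‖γ t - γ a‖ ^ 2) := by gcongr
      _ = _ := by ring
  have hξ : Tendsto (fun t ↦ (t - a)⁻¹ • v (γ t) 1) (𝓝[>] a) (𝓝 (γ' a)) := by
    have := hdiff.add hslope
    rw [zero_add] at this
    refine this.congr fun t ↦ ?_
    rw [← smul_add, sub_add_cancel]
  have hG : Tendsto (fun t ↦ G (γ t)) (𝓝[>] a) (𝓝 (G (γ a))) :=
    (hγ.continuousOn_metric hb a ha).mono_left hle
  have hγ' : Tendsto γ' (𝓝[>] a) (𝓝 (γ' a)) := (hγ.continuousOn_vel a ha).mono_left hle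
  have hA := ContinuousLinearMap.tendsto_apply hG hξ
  have h1 := (ContinuousLinearMap.tendsto_apply hA hξ).eventually_lt_const (hγ.timelike a ha)
  have h2 := (ContinuousLinearMap.tendsto_apply hA hγ').eventually_lt_const (hγ.timelike a ha)
  filter_upwards [h1, h2, self_mem_nhdsWithin] with t h1 h2 hta
  have hta : 0 < (t - a)⁻¹ := inv_pos.2 (sub_pos.2 hta)
  simp only [map_smul, smul_apply, smul_eq_mul] at h1 h2
  exact ⟨neg_of_mul_neg_right (neg_of_mul_neg_right h1 hta.le) hta.le,
    neg_of_mul_neg_right h2 hta.le⟩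

theorem hasDerivWithinAt_energy (hb : IsSmallLorentzBall n G B C K r y₀)
    (hγ : IsTimelikeCurveIn G (Metric.ball y₀ r) γ γ' a b)
    (hf : IsGeodesicFan B y₀ r p x v) {t : ℝ} (ht : t ∈ Icc a b) :
    HasDerivWithinAt (fun t ↦ G (γ t) (v (γ t) 1) (v (γ t) 1)) (2 * G (γ t) (v (γ t) 1) (γ' t))
      (Icc a b) t :=
  (hf.hasFDerivAt_energy hb (hγ.mem t ht)).comp_hasDerivWithinAt t (hγ.hasDeriv t ht)

/-- The points of a timelike curve are joined to its source by timelike geodesics. -/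
theorem neg (hb : IsSmallLorentzBall n G B C K r y₀)
    (hγ : IsTimelikeCurveIn G (Metric.ball y₀ r) γ γ' a b)
    (hf : IsGeodesicFan B y₀ r (γ a) x v) :
    ∀ t ∈ Ioc a b, G (γ t) (v (γ t) 1) (v (γ t) 1) < 0 ∧ G (γ t) (v (γ t) 1) (γ' t) < 0 := by
  refine neg_of_eventually_neg (fun t ht ↦ hγ.hasDerivWithinAt_energy hb hf ht)
    (((hγ.continuousOn_metric hb).clm_apply (hγ.continuousOn_endVel hb hf)).clm_apply
      hγ.continuousOn_vel) (fun t ht hN h0 ↦ ?_) (hγ.eventually_neg hb hf)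
  have ht' := Ioc_subset_Icc_self ht
  -- If `G(ξ, γ') = 0` while `N < 0`, the reverse Cauchy-Schwarz inequality would give `0 < N *
  -- G(γ', γ') ≤ 0`.
  have h1 := (hb.lorentz _ (hγ.mem t ht')).mul_le_sq hN (γ' t)
  have h2 := mul_pos_of_neg_of_neg hN (hγ.timelike t ht')
  rw [h0] at h1
  linarith

variable (G γ γ') in
/-- The proper time along `γ`. -/
def properTime (a t : ℝ) : ℝ := ∫ s in a..t, √(-G (γ s) (γ' s) (γ' s))

theorem continuousOn_speed (hb : IsSmallLorentzBall n G B C K r y₀)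
    (hγ : IsTimelikeCurveIn G (Metric.ball y₀ r) γ γ' a b) :
    ContinuousOn (fun t ↦ √(-G (γ t) (γ' t) (γ' t))) (Icc a b) :=
  (((hγ.continuousOn_metric hb).clm_apply hγ.continuousOn_vel).clm_apply
      hγ.continuousOn_vel).neg.sqrt

theorem hasDerivWithinAt_properTime (hb : IsSmallLorentzBall n G B C K r y₀)
    (hγ : IsTimelikeCurveIn G (Metric.ball y₀ r) γ γ' a b) {t : ℝ} (ht : t ∈ Icc a b) :
    HasDerivWithinAt (properTime G γ γ' a) (√(-G (γ t) (γ' t) (γ' t))) (Icc a b) t :=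
  (hγ.continuousOn_speed hb).hasDerivWithinAt_integral ht

/-- The source is excluded because the energy vanishes there and the square root is not
differentiable at 0. -/
theorem hasDerivWithinAt_sqrt_energy (hb : IsSmallLorentzBall n G B C K r y₀)
    (hγ : IsTimelikeCurveIn G (Metric.ball y₀ r) γ γ' a b)
    (hf : IsGeodesicFan B y₀ r (γ a) x v) {t : ℝ} (ht : t ∈ Ioc a b) :
    HasDerivWithinAt (fun t ↦ √(-G (γ t) (v (γ t) 1) (v (γ t) 1)))
      (-G (γ t) (v (γ t) 1) (γ' t) / √(-G (γ t) (v (γ t) 1) (v (γ t) 1))) (Icc a b) t := by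
  have h := (hγ.neg hb hf t ht).1
  refine ((hγ.hasDerivWithinAt_energy hb hf (Ioc_subset_Icc_self ht)).fun_neg.sqrt
    (by linarith)).congr_deriv ?_
  rw [← mul_neg, mul_div_mul_left _ _ two_ne_zero]

theorem continuousOn_sqrt_energy (hb : IsSmallLorentzBall n G B C K r y₀)
    (hγ : IsTimelikeCurveIn G (Metric.ball y₀ r) γ γ' a b)
    (hf : IsGeodesicFan B y₀ r p x v) :
    ContinuousOn (fun t ↦ √(-G (γ t) (v (γ t) 1) (v (γ t) 1))) (Icc a b) :=
  ContinuousOn.sqrt (ContinuousOn.neg fun _ ht ↦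
    (hγ.hasDerivWithinAt_energy hb hf ht).continuousWithinAt)

theorem endVel_source (hb : IsSmallLorentzBall n G B C K r y₀) (hp : p ∈ Metric.ball y₀ r)
    (hf : IsGeodesicFan B y₀ r p x v) : v p 1 = 0 := by
  simpa using hf.norm_endVel_sub_sub_le hb hp

/-- The separation grows at least as fast as proper time. -/
theorem speed_le (hb : IsSmallLorentzBall n G B C K r y₀)
    (hγ : IsTimelikeCurveIn G (Metric.ball y₀ r) γ γ' a b)
    (hf : IsGeodesicFan B y₀ r (γ a) x v) {t : ℝ} (ht : t ∈ Ioc a b) :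
    √(-G (γ t) (γ' t) (γ' t)) ≤
      -G (γ t) (v (γ t) 1) (γ' t) / √(-G (γ t) (v (γ t) 1) (v (γ t) 1)) := by
  obtain ⟨hN, hh⟩ := hγ.neg hb hf t ht
  have ht' := Ioc_subset_Icc_self ht
  rw [le_div_iff₀ (Real.sqrt_pos.2 (neg_pos.2 hN)), ← Real.sqrt_mul (by linarith [hγ.timelike t ht'])]
  refine Real.sqrt_le_iff.2 ⟨by linarith, ?_⟩
  have := (hb.lorentz _ (hγ.mem t ht')).mul_le_sq hN (γ' t)
  nlinarith

/-- The integrated form of `speed_le`. Derivatives are needed only in the interior, so continuity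
suffices at the singular source. -/
theorem monotoneOn_sqrt_energy_sub (hb : IsSmallLorentzBall n G B C K r y₀)
    (hγ : IsTimelikeCurveIn G (Metric.ball y₀ r) γ γ' a b)
    (hf : IsGeodesicFan B y₀ r (γ a) x v) :
    MonotoneOn (fun t ↦ √(-G (γ t) (v (γ t) 1) (v (γ t) 1)) - properTime G γ γ' a t)
      (Icc a b) := by
  have hsub : interior (Icc a b) ⊆ Ioc a b := interior_Icc.trans_subset Ioo_subset_Ioc_self
  refine monotoneOn_of_hasDerivWithinAt_nonneg (convex_Icc a b)
    ((hγ.continuousOn_sqrt_energy hb hf).sub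
      fun t ht ↦ (hγ.hasDerivWithinAt_properTime hb ht).continuousWithinAt)
    (fun t ht ↦ ((hγ.hasDerivWithinAt_sqrt_energy hb hf (hsub ht)).sub
      (hγ.hasDerivWithinAt_properTime hb (interior_subset ht))).mono interior_subset)
    (fun t ht ↦ sub_nonneg.2 (hγ.speed_le hb hf (hsub ht)))

theorem sqrt_energy_sub_source (hb : IsSmallLorentzBall n G B C K r y₀)
    (hγ : IsTimelikeCurveIn G (Metric.ball y₀ r) γ γ' a b)
    (hf : IsGeodesicFan B y₀ r (γ a) x v) :
    √(-G (γ a) (v (γ a) 1) (v (γ a) 1)) - properTime G γ γ' a a = 0 := by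
  simp [endVel_source hb (hγ.mem a (left_mem_Icc.2 hγ.lt.le)) hf, properTime]

/-- Timelike curves are not longer than geodesics. -/
theorem properTime_le (hb : IsSmallLorentzBall n G B C K r y₀)
    (hγ : IsTimelikeCurveIn G (Metric.ball y₀ r) γ γ' a b)
    (hf : IsGeodesicFan B y₀ r (γ a) x v) :
    properTime G γ γ' a b ≤ √(-G (γ b) (v (γ b) 1) (v (γ b) 1)) := by
  have h := hγ.monotoneOn_sqrt_energy_sub hb hf (left_mem_Icc.2 hγ.lt.le)
    (right_mem_Icc.2 hγ.lt.le) hγ.lt.le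
  simp only [hγ.sqrt_energy_sub_source hb hf] at h
  linarith

/-- For a maximizing curve, the separation is the proper time. -/
theorem properTime_eq (hb : IsSmallLorentzBall n G B C K r y₀)
    (hγ : IsTimelikeCurveIn G (Metric.ball y₀ r) γ γ' a b)
    (hf : IsGeodesicFan B y₀ r (γ a) x v)
    (heq : properTime G γ γ' a b = √(-G (γ b) (v (γ b) 1) (v (γ b) 1))) :
    ∀ t ∈ Icc a b, properTime G γ γ' a t = √(-G (γ t) (v (γ t) 1) (v (γ t) 1)) := by
  intro t ht
  -- A monotone function that vanishes at both ends vanishes throughout.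
  have hm := hγ.monotoneOn_sqrt_energy_sub hb hf
  have h1 := hm (left_mem_Icc.2 hγ.lt.le) ht ht.1
  have h2 := hm ht (right_mem_Icc.2 hγ.lt.le) ht.2
  simp only [hγ.sqrt_energy_sub_source hb hf] at h1
  simp only at h2
  linarith

/-- A maximizing curve is everywhere tangent to the geodesics from its source. -/
theorem vel_eq_smul (hb : IsSmallLorentzBall n G B C K r y₀)
    (hγ : IsTimelikeCurveIn G (Metric.ball y₀ r) γ γ' a b)
    (hf : IsGeodesicFan B y₀ r (γ a) x v)
    (heq : properTime G γ γ' a b = √(-G (γ b) (v (γ b) 1) (v (γ b) 1))) {t : ℝ}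
    (ht : t ∈ Ioc a b) :
    γ' t = (√(-G (γ t) (γ' t) (γ' t)) / properTime G γ γ' a t) • v (γ t) 1 := by
  have ht' := Ioc_subset_Icc_self ht
  obtain ⟨hN, hh⟩ := hγ.neg hb hf t ht
  have hg := hγ.timelike t ht'
  have hL := hγ.properTime_eq hb hf heq
  -- Differentiating the identity between proper time and separation gives equality in the reverse
  -- Cauchy-Schwarz inequality, hence proportionality.
  have hd := (uniqueDiffOn_Icc hγ.lt t ht').eq_deriv _
    ((hγ.hasDerivWithinAt_sqrt_energy hb hf ht).congr hL (hL t ht'))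
    (hγ.hasDerivWithinAt_properTime hb ht')
  rw [hL t ht']
  have hρ := Real.sqrt_pos.2 (neg_pos.2 hN)
  have hρ2 := Real.sq_sqrt (neg_pos.2 hN).le
  have hl2 := Real.sq_sqrt (neg_pos.2 hg).le
  set ρ := √(-G (γ t) (v (γ t) 1) (v (γ t) 1))
  set l := √(-G (γ t) (γ' t) (γ' t))
  rw [div_eq_iff hρ.ne'] at hd
  have := (hb.lorentz _ (hγ.mem t ht')).eq_smul_of_mul_eq_sq hN (v := γ' t) (by
    rw [neg_eq_iff_eq_neg.1 hd, ← neg_neg (G (γ t) (v (γ t) 1) (v (γ t) 1)),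
      ← neg_neg (G (γ t) (γ' t) (γ' t)), ← hρ2, ← hl2]
    ring)
  rw [this]
  congr 1
  rw [neg_eq_iff_eq_neg.1 hd, ← neg_neg (G (γ t) (v (γ t) 1) (v (γ t) 1)), ← hρ2]
  field_simp

theorem properTime_pos (hb : IsSmallLorentzBall n G B C K r y₀)
    (hγ : IsTimelikeCurveIn G (Metric.ball y₀ r) γ γ' a b)
    (hf : IsGeodesicFan B y₀ r (γ a) x v)
    (heq : properTime G γ γ' a b = √(-G (γ b) (v (γ b) 1) (v (γ b) 1))) {t : ℝ}
    (ht : t ∈ Ioc a b) : 0 < properTime G γ γ' a t := by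
  rw [hγ.properTime_eq hb hf heq t (Ioc_subset_Icc_self ht)]
  exact Real.sqrt_pos.2 (neg_pos.2 (hγ.neg hb hf t ht).1)

theorem monotoneOn_properTime (hb : IsSmallLorentzBall n G B C K r y₀)
    (hγ : IsTimelikeCurveIn G (Metric.ball y₀ r) γ γ' a b) :
    MonotoneOn (properTime G γ γ' a) (Icc a b) :=
  monotoneOn_of_hasDerivWithinAt_nonneg (convex_Icc a b)
    (fun _ ht ↦ (hγ.hasDerivWithinAt_properTime hb ht).continuousWithinAt)
    (fun _ ht ↦ (hγ.hasDerivWithinAt_properTime hb (interior_subset ht)).mono interior_subset)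
    (fun _ _ ↦ Real.sqrt_nonneg _)

/-- A maximizing curve is a geodesic, parametrized by proper time. -/
theorem eq_geodesic (hb : IsSmallLorentzBall n G B C K r y₀)
    (hγ : IsTimelikeCurveIn G (Metric.ball y₀ r) γ γ' a b)
    (hf : IsGeodesicFan B y₀ r (γ a) x v)
    (heq : properTime G γ γ' a b = √(-G (γ b) (v (γ b) 1) (v (γ b) 1))) :
    ∀ t ∈ Icc a b, γ t = x (γ b) (properTime G γ γ' a t / properTime G γ γ' a b) := by
  have hbm : b ∈ Icc a b := right_mem_Icc.2 hγ.lt.le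
  have hbb := hγ.mem b hbm
  have hTb : 0 < properTime G γ γ' a b := hγ.properTime_pos hb hf heq (right_mem_Ioc.2 hγ.lt)
  set φ : ℝ → ℝ := fun t ↦ properTime G γ γ' a t / properTime G γ γ' a b with hφ
  have hφd : ∀ t ∈ Icc a b, HasDerivWithinAt φ
      (√(-G (γ t) (γ' t) (γ' t)) / properTime G γ γ' a b) (Icc a b) t := fun t ht ↦
    (hγ.hasDerivWithinAt_properTime hb ht).div_const _
  have hφm : MapsTo φ (Icc a b) (Icc 0 1) := fun t ht ↦ by
    constructor
    · refine div_nonneg ?_ hTb.le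
      simpa [properTime] using hγ.monotoneOn_properTime hb (left_mem_Icc.2 hγ.lt.le) ht ht.1
    · rw [div_le_one hTb]
      exact hγ.monotoneOn_properTime hb ht hbm ht.2
  have hyd : ∀ t ∈ Icc a b, HasDerivWithinAt (fun t ↦ x (γ b) (φ t))
      ((√(-G (γ t) (γ' t) (γ' t)) / properTime G γ γ' a b) • v (γ b) (φ t)) (Icc a b) t :=
    fun t ht ↦ ((hf.isSprayCurve _ hbb).hasDeriv _ (hφm ht)).scomp t (hφd t ht) hφm
  intro t ht
  rcases ht.1.eq_or_lt with rfl | hat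
  · simp [properTime, hf.source _ hbb]
  have hsub : Icc t b ⊆ Icc a b := Icc_subset_Icc_left ht.1
  have hsub' : Ioc t b ⊆ Ioc a b := Ioc_subset_Ioc_left ht.1
  have hsubc : Icc t b ⊆ Ioc a b := fun s hs ↦ ⟨hat.trans_le hs.1, hs.2⟩
  have hmem : ∀ s ∈ Ioc t b, Icc a b ∈ 𝓝[≤] s := fun s hs ↦
    mem_of_superset (Icc_mem_nhdsLE_of_mem hs) hsub
  -- Both curves solve `y' = l(s) ξ(y)`. The factor `l` is singular at `a`, where proper time is 0,
  -- so the equation is solved backwards from `b`, where both curves are at `γ b`.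
  set l : ℝ → ℝ := fun t ↦ √(-G (γ t) (γ' t) (γ' t)) / properTime G γ γ' a t with hl
  have hlc : ContinuousOn l (Icc t b) :=
    ((hγ.continuousOn_speed hb).mono hsub).div
      (fun s hs ↦ ((hγ.hasDerivWithinAt_properTime hb (hsub hs)).continuousWithinAt.mono hsub))
      (fun s hs ↦ (hγ.properTime_pos hb hf heq (hsubc hs)).ne')
  obtain ⟨m, hm⟩ := isCompact_Icc.exists_bound_of_continuousOn hlc
  refine ODE_solution_unique_of_mem_Icc_left (v := fun s y ↦ l s • v y 1)
    (s := fun _ ↦ Metric.ball y₀ r) (K := m.toNNReal * 2) (fun s hs ↦ ?_)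
    (hγ.continuousOn.mono hsub) (fun s hs ↦ ?_) (fun s hs ↦ hγ.mem s (hsub (Ioc_subset_Icc_self hs)))
    (fun s hs ↦ (hyd s (hsub hs)).continuousWithinAt.mono hsub) (fun s hs ↦ ?_)
    (fun s hs ↦ hf.mem _ hbb _ (hφm (hsub (Ioc_subset_Icc_self hs)))) ?_ (left_mem_Icc.2 ht.2)
  · have hls : ‖l s‖₊ ≤ m.toNNReal := by
      rw [← NNReal.coe_le_coe, coe_nnnorm]
      exact (hm s (Ioc_subset_Icc_self hs)).trans (Real.le_coe_toNNReal m)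
    exact ((lipschitzWith_smul (l s)).comp_lipschitzOnWith (hf.lipschitzOnWith_endVel hb)).weaken
      (mul_le_mul_left hls 2)
  · have hs' := hsub (Ioc_subset_Icc_self hs)
    refine ((hγ.hasDeriv s hs').mono_of_mem_nhdsWithin (hmem s hs)).congr_deriv ?_
    exact hγ.vel_eq_smul hb hf heq (hsub' hs)
  · have hs' := hsub (Ioc_subset_Icc_self hs)
    refine ((hyd s hs').mono_of_mem_nhdsWithin (hmem s hs)).congr_deriv ?_
    have := hγ.properTime_pos hb hf heq (hsub' hs)
    -- Since `ξ(x(φ)) = φ • v(φ)`, the factor `φ` turns division by the proper time up to `s` into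
    -- division by the total proper time.
    rw [hf.endVel_apply hb hbb (hφm hs'), smul_smul]
    congr 1
    simp only [hl, hφ]
    field_simp
  · simp only [hφ]
    rw [div_self hTb.ne', hf.target _ hbb]

/-- The parameter change of a maximizing curve. -/
theorem exists_reparametrization (hb : IsSmallLorentzBall n G B C K r y₀)
    (hγ : IsTimelikeCurveIn G (Metric.ball y₀ r) γ γ' a b)
    (hf : IsGeodesicFan B y₀ r (γ a) x v)
    (heq : properTime G γ γ' a b = √(-G (γ b) (v (γ b) 1) (v (γ b) 1))) :
    ∃ φ : ℝ → ℝ, ContDiffOn ℝ 1 φ (Icc a b) ∧ (∀ t ∈ Icc a b, 0 < derivWithin φ (Icc a b) t) ∧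
      φ a = 0 ∧ φ b = 1 ∧ ∀ t ∈ Icc a b, γ t = x (γ b) (φ t) := by
  have hTb : 0 < properTime G γ γ' a b := hγ.properTime_pos hb hf heq (right_mem_Ioc.2 hγ.lt)
  have hu := uniqueDiffOn_Icc hγ.lt
  have hφd : ∀ t ∈ Icc a b, HasDerivWithinAt
      (fun t ↦ properTime G γ γ' a t / properTime G γ γ' a b)
      (√(-G (γ t) (γ' t) (γ' t)) / properTime G γ γ' a b) (Icc a b) t := fun t ht ↦
    (hγ.hasDerivWithinAt_properTime hb ht).div_const _
  refine ⟨fun t ↦ properTime G γ γ' a t / properTime G γ γ' a b, ?_, fun t ht ↦ ?_,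
    by simp [properTime], div_self hTb.ne', hγ.eq_geodesic hb hf heq⟩
  · rw [contDiffOn_one_iff_derivWithin hu]
    refine ⟨fun t ht ↦ (hφd t ht).differentiableWithinAt, ?_⟩
    exact ((hγ.continuousOn_speed hb).div_const _).congr fun t ht ↦ (hφd t ht).derivWithin (hu t ht)
  · rw [(hφd t ht).derivWithin (hu t ht)]
    exact div_pos (Real.sqrt_pos.2 (neg_pos.2 (hγ.timelike t ht))) hTb

end IsTimelikeCurveIn

end LocalTwinParadox

/-! ### The geodesic spray and existence of small Lorentz balls -/

section SmallBalls

set_option maxSynthPendingDepth 3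

open Filter

variable {n : ℕ} {E : Type*} [NormedAddCommGroup E] [InnerProductSpace ℝ E]

theorem IsLorentzForm.isInvertible [FiniteDimensional ℝ E] {A : E →L[ℝ] E →L[ℝ] ℝ}
    (hA : IsLorentzForm n A) : A.IsInvertible := by
  have hr : Module.finrank ℝ E = Module.finrank ℝ (E →L[ℝ] ℝ) := by
    rw [← (LinearMap.toContinuousLinearMap (𝕜 := ℝ) (E := E) (F' := ℝ)).finrank_eq]
    exact Subspace.dual_finrank_eq.symm
  exact ⟨(LinearMap.linearEquivOfInjective (A : E →ₗ[ℝ] E →L[ℝ] ℝ) hA.injective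
    hr).toContinuousLinearEquiv, by ext; rfl⟩

/-- The geodesic equation for the metric `G`, with the index lowered. -/
def GeodesicEq (G : E → E →L[ℝ] E →L[ℝ] ℝ) (y v a : E) : Prop :=
  ∀ w, G y a w + (fderiv ℝ G y v v w - fderiv ℝ G y w v v / 2) = 0

variable (E) in
/-- The map `D ↦ (u, v, w) ↦ D u v w - D w u v / 2`. -/
def christoffelMap : (E →L[ℝ] E →L[ℝ] E →L[ℝ] ℝ) →L[ℝ] (E →L[ℝ] E →L[ℝ] E →L[ℝ] ℝ) :=
  ContinuousLinearMap.id ℝ _ - (1 / 2 : ℝ) •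
    (ContinuousLinearMap.compL ℝ E (E →L[ℝ] E →L[ℝ] ℝ) (E →L[ℝ] E →L[ℝ] ℝ)
      (ContinuousLinearMap.flipₗᵢ ℝ E E ℝ : (E →L[ℝ] E →L[ℝ] ℝ) →L[ℝ] (E →L[ℝ] E →L[ℝ] ℝ))).comp
    (ContinuousLinearMap.flipₗᵢ ℝ E E (E →L[ℝ] ℝ) :
      (E →L[ℝ] E →L[ℝ] E →L[ℝ] ℝ) →L[ℝ] (E →L[ℝ] E →L[ℝ] E →L[ℝ] ℝ))

theorem christoffelMap_apply (D : E →L[ℝ] E →L[ℝ] E →L[ℝ] ℝ) (u v w : E) :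
    christoffelMap E D u v w = D u v w - D w u v / 2 := by
  simp [christoffelMap]
  ring

/-- The geodesic spray of the metric `G`. -/
def geodesicSpray (G : E → E →L[ℝ] E →L[ℝ] ℝ) (y : E) : E →L[ℝ] E →L[ℝ] E :=
  -(ContinuousLinearMap.compL ℝ E (E →L[ℝ] ℝ) E (G y).inverse).comp
    (christoffelMap E (fderiv ℝ G y))

/-- Only the quadratic form `v ↦ B(v, v)` enters the geodesic equation. The Christoffel term needs
no symmetrization in its first two arguments, as two of its three derivative terms coincide on the
diagonal. -/
theorem apply_geodesicSpray {G : E → E →L[ℝ] E →L[ℝ] ℝ} {y : E} (h : (G y).IsInvertible)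
    (v w : E) :
    G y (geodesicSpray G y v v) w = fderiv ℝ G y w v v / 2 - fderiv ℝ G y v v w := by
  have : geodesicSpray G y v v = -(G y).inverse (christoffelMap E (fderiv ℝ G y) v v) := rfl
  rw [this, map_neg, h.self_apply_inverse, neg_apply, christoffelMap_apply]
  ring

/-- Class `C¹` is what yields a Lipschitz constant after a cutoff. Building the spray from
continuous linear maps and the inverse reduces its smoothness to theirs. -/
theorem contDiffAt_geodesicSpray [CompleteSpace E] {G : E → E →L[ℝ] E →L[ℝ] ℝ} {y : E}
    (h : (G y).IsInvertible) (hG : ContDiffAt ℝ ∞ G y) : ContDiffAt ℝ 1 (geodesicSpray G) y := by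
  have h1 : ContDiffAt ℝ 1 (fderiv ℝ G) y :=
    hG.fderiv_right (m := 1) (WithTop.coe_le_coe.2 le_top)
  have h2 : ContDiffAt ℝ 1 (fun y ↦ (G y).inverse) y :=
    (h.contDiffAt_map_inverse (n := 1)).comp y (hG.of_le (by exact_mod_cast (le_top : (1 : ℕ∞) ≤ ⊤)))
  have h3 : ContDiffAt ℝ 1 (fun y ↦ christoffelMap E (fderiv ℝ G y)) y :=
    (christoffelMap E).contDiff.contDiffAt.comp y h1
  have h4 : ContDiffAt ℝ 1
      (fun y ↦ ContinuousLinearMap.compL ℝ E (E →L[ℝ] ℝ) E (G y).inverse) y :=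
    (ContinuousLinearMap.compL ℝ E (E →L[ℝ] ℝ) E).contDiff.contDiffAt.comp y h2
  exact (h4.clm_comp h3).neg

/-- Every point of a Lorentzian metric is the center of a small ball. -/
theorem exists_isSmallLorentzBall [FiniteDimensional ℝ E] {G : E → E →L[ℝ] E →L[ℝ] ℝ} {U : Set E}
    (hU : IsOpen U) (hG : ContDiffOn ℝ ∞ G U) (hL : ∀ y ∈ U, IsLorentzForm n (G y)) {y₀ : E}
    (hy₀ : y₀ ∈ U) :
    ∃ B C K r, IsSmallLorentzBall n G B C K r y₀ ∧ Metric.ball y₀ r ⊆ U := by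
  have := FiniteDimensional.complete ℝ E
  have hGat : ∀ y ∈ U, ContDiffAt ℝ ∞ G y := fun y hy ↦ hG.contDiffAt (hU.mem_nhds hy)
  have hGd : ∀ y ∈ U, DifferentiableAt ℝ G y := fun y hy ↦
    (hGat y hy).differentiableAt (by simp)
  obtain ⟨R, hR, hRU⟩ := Metric.nhds_basis_closedBall.mem_iff.1 (hU.mem_nhds hy₀)
  -- The cutoff makes the spray globally bounded and Lipschitz without changing it on the ball of
  -- radius `R / 2`.
  let χ : ContDiffBump y₀ := ⟨R / 2, R, half_pos hR, half_lt_self hR⟩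
  set B : E → E →L[ℝ] E →L[ℝ] E := fun y ↦ χ y • geodesicSpray G y with hB
  have hBsupp : HasCompactSupport B := χ.hasCompactSupport.smul_right
  have hBd : ContDiff ℝ 1 B := by
    rw [contDiff_iff_contDiffAt]
    intro y
    by_cases hy : y ∈ tsupport B
    · have hyU : y ∈ U := hRU (by
        have := tsupport_smul_subset_left _ _ hy
        rwa [χ.tsupport_eq] at this)
      exact χ.contDiffAt.smul (contDiffAt_geodesicSpray (hL y hyU).isInvertible (hGat y hyU))
    · exact contDiffAt_const.congr_of_eventuallyEq (notMem_tsupport_iff_eventuallyEq.1 hy)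
  obtain ⟨C₁, hC₁⟩ := hBsupp.exists_bound_of_continuous hBd.continuous
  obtain ⟨C₂, hC₂⟩ := hBd.lipschitzWith_of_hasCompactSupport hBsupp one_ne_zero
  obtain ⟨L, s, hs, hLs⟩ := ((hGat y₀ hy₀).fderiv_right (m := 1)
    (WithTop.coe_le_coe.2 le_top)).exists_lipschitzOnWith
  have hev1 : ∀ᶠ y in 𝓝 y₀, ‖G y‖ < ‖G y₀‖ + 1 :=
    (hGat y₀ hy₀).continuousAt.norm.eventually_lt_const (lt_add_one _)
  have hev2 : ∀ᶠ y in 𝓝 y₀, ‖fderiv ℝ G y‖ < ‖fderiv ℝ G y₀‖ + 1 :=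
    ((hGat y₀ hy₀).fderiv_right (m := 0)
      (by exact_mod_cast (le_top : (0 + 1 : ℕ∞) ≤ ⊤))).continuousAt.norm.eventually_lt_const
      (lt_add_one _)
  obtain ⟨ρ, hρ, hball⟩ := Metric.eventually_nhds_iff_ball.1
    (hev1.and (hev2.and (hs : ∀ᶠ y in 𝓝 y₀, y ∈ s)))
  set C : ℝ := max 1 (max C₁ C₂) with hC
  set K : ℝ := max L (max (‖G y₀‖ + 1) (‖fderiv ℝ G y₀‖ + 1)) with hK
  have hC1 : 1 ≤ C := le_max_left _ _
  -- The three bounds ensure in turn that the cutoff is 1, that `G` and its derivative are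
  -- controlled, and that the geodesic estimates apply.
  set r := min (min (R / 2) ρ) (1 / (100 * C)) with hr
  have hrR : r ≤ R / 2 := (min_le_left _ _).trans (min_le_left _ _)
  have hrρ : r ≤ ρ := (min_le_left _ _).trans (min_le_right _ _)
  have hrC : r ≤ 1 / (100 * C) := min_le_right _ _
  have hbU : Metric.ball y₀ r ⊆ U :=
    (Metric.ball_subset_closedBall.trans (Metric.closedBall_subset_closedBall (by linarith))).trans
      hRU
  have hbρ : ∀ y ∈ Metric.ball y₀ r, _ := fun y hy ↦ hball y (Metric.ball_subset_ball hrρ hy)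
  refine ⟨B, C, K, r, ⟨fun y hy ↦ hL y (hbU hy), fun y hy ↦ hGd y (hbU hy), fun y hy z hz ↦ ?_,
    fun y hy ↦ (hbρ y hy).1.le.trans ((le_max_left _ _).trans (le_max_right _ _)),
    fun y hy ↦ (hbρ y hy).2.1.le.trans ((le_max_right _ _).trans (le_max_right _ _)),
    fun y hy v w ↦ ?_, fun y ↦ (hC₁ y).trans ((le_max_left _ _).trans (le_max_right _ _)),
    fun y z ↦ ?_, hC1, by positivity, ?_⟩, hbU⟩
  · have hseg : segment ℝ y z ⊆ Metric.ball y₀ r := (convex_ball y₀ r).segment_subset hy hz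
    have := (convex_segment (𝕜 := ℝ) y z).norm_image_sub_le_of_norm_hasFDerivWithin_le'
      (f := G) (φ := fderiv ℝ G y) (C := K * ‖z - y‖)
      (fun x hx ↦ (hGd x (hbU (hseg hx))).hasFDerivAt.hasFDerivWithinAt) (fun x hx ↦ ?_)
      (left_mem_segment ℝ y z) (right_mem_segment ℝ y z)
    · rwa [mul_assoc, ← sq] at this
    · have h1 := hLs.norm_sub_le (hbρ x (hseg hx)).2.2 (hbρ y hy).2.2
      refine h1.trans ?_
      gcongr
      · exact le_max_left _ _
      · exact norm_sub_le_of_mem_segment hx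
  · have hχ : χ y = 1 := χ.one_of_mem_closedBall
      (Metric.ball_subset_closedBall (Metric.ball_subset_ball hrR hy))
    have : B y = geodesicSpray G y := by rw [hB]; simp only [hχ, one_smul]
    rw [this]
    exact apply_geodesicSpray (hL y (hbU hy)).isInvertible v w
  · refine (hC₂.norm_sub_le y z).trans ?_
    gcongr
    exact (le_max_right _ _).trans (le_max_right _ _)
  · rw [le_div_iff₀ (by positivity)] at hrC
    linarith

/-- Nondegeneracy allows the lowered index to be raised, so that the equation is solved for the
acceleration. -/
theorem IsSmallLorentzBall.geodesicEq_iff {G : E → E →L[ℝ] E →L[ℝ] ℝ}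
    {B : E → E →L[ℝ] E →L[ℝ] E} {C K r : ℝ} {y₀ y : E} (hb : IsSmallLorentzBall n G B C K r y₀)
    (hy : y ∈ Metric.ball y₀ r) {v a : E} : GeodesicEq G y v a ↔ a = B y v v := by
  constructor
  · intro h
    refine (hb.lorentz y hy).injective ?_
    ext w
    rw [hb.spray y hy]
    linarith [h w]
  · rintro rfl w
    rw [hb.spray y hy]
    ring

end SmallBalls

/-! ### The metric in a chart -/

namespace LorentzianMetric

set_option maxSynthPendingDepth 3

open Filter

variable {n : ℕ} {M : Type*} [TopologicalSpace M]
  [ChartedSpace (EuclideanSpace ℝ (Fin (n + 1))) M] [IsManifold (𝓡 (n + 1)) ∞ M]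
  (g : LorentzianMetric n M)
  {e : OpenPartialHomeomorph M (EuclideanSpace ℝ (Fin (n + 1)))}

/-- The metric in a chart, as a field of bilinear forms. -/
def coordMetric (e : OpenPartialHomeomorph M (EuclideanSpace ℝ (Fin (n + 1))))
    (y : EuclideanSpace ℝ (Fin (n + 1))) :
    EuclideanSpace ℝ (Fin (n + 1)) →L[ℝ] EuclideanSpace ℝ (Fin (n + 1)) →L[ℝ] ℝ :=
  ContinuousLinearMap.bilinearComp (E := EuclideanSpace ℝ (Fin (n + 1)))
    (F := EuclideanSpace ℝ (Fin (n + 1))) (g.inner (e.symm y))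
    (mfderiv 𝓘(ℝ, EuclideanSpace ℝ (Fin (n + 1))) (𝓡 (n + 1)) e.symm y)
    (mfderiv 𝓘(ℝ, EuclideanSpace ℝ (Fin (n + 1))) (𝓡 (n + 1)) e.symm y)

theorem coordMetric_apply (y u v : EuclideanSpace ℝ (Fin (n + 1))) :
    g.coordMetric e y u v = g.chartMetric e y u v := rfl

theorem contDiffOn_coordMetric (he : e ∈ IsManifold.maximalAtlas (𝓡 (n + 1)) ∞ M) :
    ContDiffOn ℝ ∞ (g.coordMetric e) e.target := by
  have hsymm := contMDiffOn_symm_of_mem_maximalAtlas he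
  -- Smoothness is tested on pairs of constant coordinate fields, which the inverse chart carries to
  -- smooth fields on `M`.
  have hfield : ∀ u : EuclideanSpace ℝ (Fin (n + 1)),
      ContMDiffOn (𝓡 (n + 1)) (𝓡 (n + 1)).tangent ∞
        (fun y ↦ (⟨e.symm y, mfderiv (𝓡 (n + 1)) (𝓡 (n + 1)) e.symm y u⟩ :
          TangentBundle (𝓡 (n + 1)) M)) e.target := by
    intro u
    have h1 : ContMDiff (𝓡 (n + 1)) (𝓡 (n + 1)).tangent ∞
        (fun y ↦ (⟨y, u⟩ : TangentBundle (𝓡 (n + 1)) (EuclideanSpace ℝ (Fin (n + 1))))) :=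
      contMDiff_vectorSpace_iff_contDiff.2 contDiff_const
    have h2 := hsymm.contMDiffOn_tangentMapWithin (m := ∞) (by simp)
      e.open_target.uniqueMDiffOn
    refine (h2.comp h1.contMDiffOn (fun y hy ↦ hy)).congr fun y hy ↦ ?_
    simp only [Function.comp, tangentMapWithin, mfderivWithin_of_isOpen e.open_target hy]
  rw [contDiffOn_clm_apply]
  intro u
  rw [contDiffOn_clm_apply]
  intro v
  rw [← contMDiffOn_iff_contDiffOn]
  intro y hy
  have : ContMDiffWithinAt (𝓡 (n + 1)) ((𝓡 (n + 1)).prod 𝓘(ℝ)) ∞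
      (fun m ↦ Bundle.TotalSpace.mk' ℝ (E := Bundle.Trivial M ℝ) (e.symm m)
        (g.inner (e.symm m) (mfderiv (𝓡 (n + 1)) (𝓡 (n + 1)) e.symm m u)
          (mfderiv (𝓡 (n + 1)) (𝓡 (n + 1)) e.symm m v))) e.target y := by
    apply ContMDiffWithinAt.clm_bundle_apply₂ (F₁ := EuclideanSpace ℝ (Fin (n + 1)))
      (F₂ := EuclideanSpace ℝ (Fin (n + 1)))
    · exact ContMDiffAt.comp_contMDiffWithinAt y g.contMDiff.contMDiffAt (hsymm y hy)
    · exact hfield u y hy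
    · exact hfield v y hy
  simp only [Bundle.contMDiffWithinAt_totalSpace] at this
  exact this.2

theorem isLorentzForm_coordMetric (he : e ∈ IsManifold.maximalAtlas (𝓡 (n + 1)) ∞ M)
    {y : EuclideanSpace ℝ (Fin (n + 1))} (hy : y ∈ e.target) :
    IsLorentzForm n (g.coordMetric e y) := by
  refine ⟨fun v w ↦ g.symm _ _ _, ?_⟩
  obtain ⟨b, hb⟩ := g.signature (e.symm y)
  have hd : e.MDifferentiable (𝓡 (n + 1)) (𝓡 (n + 1)) :=
    ⟨(contMDiffOn_of_mem_maximalAtlas he).mdifferentiableOn (by simp),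
      (contMDiffOn_symm_of_mem_maximalAtlas he).mdifferentiableOn (by simp)⟩
  let A : EuclideanSpace ℝ (Fin (n + 1)) ≃L[ℝ] TangentSpace (𝓡 (n + 1)) (e.symm y) :=
    hd.symm.mfderiv hy
  refine ⟨b.map A.symm.toLinearEquiv, fun i j ↦ ?_⟩
  have hA : ∀ i, A (b.map A.symm.toLinearEquiv i) = b i := fun i ↦ A.apply_symm_apply (b i)
  rw [← hb i j, ← hA i, ← hA j]
  rfl

end LorentzianMetric

/-! ### Invariance of the geodesic equation under coordinate changes -/

section ChangeOfCoordinates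

set_option maxSynthPendingDepth 3

variable {E : Type*} [NormedAddCommGroup E] [InnerProductSpace ℝ E]

/-- The geodesic equation is invariant under changes of coordinates. -/
theorem GeodesicEq.map {G G' : E → E →L[ℝ] E →L[ℝ] ℝ} {φ : E → E} {y v a : E}
    (h : GeodesicEq G y v a) (hφ : ContDiffAt ℝ 2 φ y) (hG : DifferentiableAt ℝ G y)
    (hG' : DifferentiableAt ℝ G' (φ y)) (hsymm : ∀ u v, G' (φ y) u v = G' (φ y) v u)
    (hsurj : Function.Surjective (fderiv ℝ φ y))
    (hGG' : ∀ᶠ z in 𝓝 y, ∀ u v, G z u v = G' (φ z) (fderiv ℝ φ z u) (fderiv ℝ φ z v)) :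
    GeodesicEq G' (φ y) (fderiv ℝ φ y v) (fderiv ℝ (fderiv ℝ φ) y v v + fderiv ℝ φ y a) := by
  have hφ1 : HasFDerivAt φ (fderiv ℝ φ y) y := (hφ.differentiableAt two_ne_zero).hasFDerivAt
  have hφ2 : HasFDerivAt (fderiv ℝ φ) (fderiv ℝ (fderiv ℝ φ) y) y :=
    ((hφ.fderiv_right (m := 1) one_add_one_eq_two.le).differentiableAt one_ne_zero).hasFDerivAt
  have hs : ∀ u w, fderiv ℝ (fderiv ℝ φ) y u w = fderiv ℝ (fderiv ℝ φ) y w u :=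
    hφ.isSymmSndFDerivAt (by simp)
  -- The transformation law of the metric, differentiated. The second derivatives of `φ` that it
  -- produces combine, by their symmetry, to the term `D²φ(v, v)` in the transformed acceleration.
  have key : ∀ k u w, fderiv ℝ G y k u w =
      fderiv ℝ G' (φ y) (fderiv ℝ φ y k) (fderiv ℝ φ y u) (fderiv ℝ φ y w)
        + G' (φ y) (fderiv ℝ (fderiv ℝ φ) y k u) (fderiv ℝ φ y w)
        + G' (φ y) (fderiv ℝ φ y u) (fderiv ℝ (fderiv ℝ φ) y k w) := by
    intro k u w
    have h1 := (hG.hasFDerivAt.clm_apply (hasFDerivAt_const u y)).clm_apply (hasFDerivAt_const w y)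
    have h2 := (((hG'.hasFDerivAt.comp y hφ1).clm_apply
      (hφ2.clm_apply (hasFDerivAt_const u y)))).clm_apply (hφ2.clm_apply (hasFDerivAt_const w y))
    have h3 := DFunLike.congr_fun
      (h1.unique (h2.congr_of_eventuallyEq (hGG'.mono fun z hz ↦ hz u w))) k
    simp at h3
    rw [h3]
    ring
  intro w'
  obtain ⟨w, rfl⟩ := hsurj w'
  have h1 := h w
  rw [key, key, hGG'.self_of_nhds] at h1
  rw [← h1, map_add, add_apply, hs w v, hsymm (fderiv ℝ (fderiv ℝ φ) y v w)]
  ring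

end ChangeOfCoordinates

section Charts

variable {n : ℕ} {M : Type*} [TopologicalSpace M]
  [ChartedSpace (EuclideanSpace ℝ (Fin (n + 1))) M]
  {e e' : OpenPartialHomeomorph M (EuclideanSpace ℝ (Fin (n + 1)))}

theorem mdifferentiableAt_chart_symm (he : e ∈ IsManifold.maximalAtlas (𝓡 (n + 1)) ∞ M)
    {y : EuclideanSpace ℝ (Fin (n + 1))} (hy : y ∈ e.target) :
    MDifferentiableAt (𝓡 (n + 1)) (𝓡 (n + 1)) e.symm y :=
  ((contMDiffOn_symm_of_mem_maximalAtlas he).contMDiffAt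
    (e.open_target.mem_nhds hy)).mdifferentiableAt (by simp)

theorem contDiffAt_transition (he : e ∈ IsManifold.maximalAtlas (𝓡 (n + 1)) ∞ M)
    (he' : e' ∈ IsManifold.maximalAtlas (𝓡 (n + 1)) ∞ M)
    {y : EuclideanSpace ℝ (Fin (n + 1))} (hy : y ∈ e.target) (hy' : e.symm y ∈ e'.source) :
    ContDiffAt ℝ ∞ (e' ∘ e.symm) y := by
  rw [← contMDiffAt_iff_contDiffAt]
  exact (contMDiffAt_of_mem_maximalAtlas he' hy').comp y
    ((contMDiffOn_symm_of_mem_maximalAtlas he).contMDiffAt (e.open_target.mem_nhds hy))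

end Charts

/-! ### Metric, velocities and geodesics in two charts -/

namespace LorentzianMetric

set_option maxSynthPendingDepth 3

open Filter

variable {n : ℕ} {M : Type*} [TopologicalSpace M]
  [ChartedSpace (EuclideanSpace ℝ (Fin (n + 1))) M] [IsManifold (𝓡 (n + 1)) ∞ M]
  (g : LorentzianMetric n M)
  {e e' : OpenPartialHomeomorph M (EuclideanSpace ℝ (Fin (n + 1)))}

theorem differentiableAt_coordMetric (he : e ∈ IsManifold.maximalAtlas (𝓡 (n + 1)) ∞ M)
    {y : EuclideanSpace ℝ (Fin (n + 1))} (hy : y ∈ e.target) :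
    DifferentiableAt ℝ (g.coordMetric e) y :=
  ((g.contDiffOn_coordMetric he).contDiffAt (e.open_target.mem_nhds hy)).differentiableAt (by simp)

theorem geodesicEq_coordMetric_iff (he : e ∈ IsManifold.maximalAtlas (𝓡 (n + 1)) ∞ M)
    {y : EuclideanSpace ℝ (Fin (n + 1))} (hy : y ∈ e.target)
    {v a : EuclideanSpace ℝ (Fin (n + 1))} :
    GeodesicEq (g.coordMetric e) y v a ↔
      ∀ w, g.chartMetric e y a w + g.christoffel e y v v w = 0 := by
  have hd := (g.differentiableAt_coordMetric he hy).hasFDerivAt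
  have h : ∀ u w k : EuclideanSpace ℝ (Fin (n + 1)), fderiv ℝ (fun z ↦ g.chartMetric e z u w) y k
      = fderiv ℝ (g.coordMetric e) y k u w := fun u w k ↦ by
    have h1 : HasFDerivAt (fun z ↦ g.chartMetric e z u w) _ y :=
      (hd.clm_apply (hasFDerivAt_const u y)).clm_apply (hasFDerivAt_const w y)
    rw [h1.fderiv]
    simp
  refine forall_congr' fun w ↦ ?_
  rw [christoffel, h, h, coordMetric_apply]
  ring_nf

/-- All tangent spaces are definitionally the model space, so vectors can be compared there even if
their base points are only provably equal. -/
theorem inner_congr {x x' : M} (h : x = x') {u v u' v' : EuclideanSpace ℝ (Fin (n + 1))}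
    (hu : u = u') (hv : v = v') : g.inner x u v = g.inner x' u' v' := by
  subst h hu hv; rfl

theorem coordMetric_eq_transition (he : e ∈ IsManifold.maximalAtlas (𝓡 (n + 1)) ∞ M)
    (he' : e' ∈ IsManifold.maximalAtlas (𝓡 (n + 1)) ∞ M)
    {y : EuclideanSpace ℝ (Fin (n + 1))} (hy : y ∈ e.target) (hy' : e.symm y ∈ e'.source)
    (u v : EuclideanSpace ℝ (Fin (n + 1))) :
    g.coordMetric e y u v = g.coordMetric e' (e' (e.symm y)) (fderiv ℝ (e' ∘ e.symm) y u)
      (fderiv ℝ (e' ∘ e.symm) y v) := by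
  have hopen : IsOpen (e.target ∩ e.symm ⁻¹' e'.source) :=
    e.symm.isOpen_inter_preimage e'.open_source
  have h1 : HasMFDerivAt (𝓡 (n + 1)) (𝓡 (n + 1)) (e' ∘ e.symm) y (fderiv ℝ (e' ∘ e.symm) y) :=
    ((contDiffAt_transition he he' hy hy').differentiableAt (by simp)).hasFDerivAt.hasMFDerivAt
  have h2 := (mdifferentiableAt_chart_symm he' (e'.map_source hy')).hasMFDerivAt.comp
    (I'' := 𝓡 (n + 1)) y h1
  have h3 : (e'.symm ∘ (e' ∘ e.symm)) =ᶠ[𝓝 y] e.symm :=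
    Filter.eventually_of_mem (hopen.mem_nhds ⟨hy, hy'⟩) fun z hz ↦ e'.left_inv hz.2
  have h4 : ∀ u : EuclideanSpace ℝ (Fin (n + 1)), (mfderiv (𝓡 (n + 1)) (𝓡 (n + 1)) e.symm y u :
      EuclideanSpace ℝ (Fin (n + 1))) = mfderiv (𝓡 (n + 1)) (𝓡 (n + 1)) e'.symm (e' (e.symm y))
        (fderiv ℝ (e' ∘ e.symm) y u) := fun u ↦
    DFunLike.congr_fun (h2.congr_of_eventuallyEq h3.symm).mfderiv u
  exact g.inner_congr (e'.left_inv hy').symm (h4 u) (h4 v)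

/-- The velocity of a curve in a chart. -/
theorem inner_velocity (he : e ∈ IsManifold.maximalAtlas (𝓡 (n + 1)) ∞ M) {γ : ℝ → M} {a b t : ℝ}
    (hab : a < b) (hγ : MapsTo γ (Icc a b) e.source) (ht : t ∈ Icc a b)
    {v : EuclideanSpace ℝ (Fin (n + 1))} (hv : HasDerivWithinAt (e ∘ γ) v (Icc a b) t) :
    g.inner (γ t) (velocity n γ a b t) (velocity n γ a b t) = g.coordMetric e (e (γ t)) v v := by
  have h1 := (mdifferentiableAt_chart_symm he (e.map_source (hγ ht))).hasMFDerivAt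
    |>.comp_hasMFDerivWithinAt t hv.hasFDerivWithinAt.hasMFDerivWithinAt
  have h2 := h1.congr_of_eventuallyEq (f₁ := γ)
    (Filter.eventually_of_mem self_mem_nhdsWithin fun s hs ↦ (e.left_inv (hγ hs)).symm)
    (e.left_inv (hγ ht)).symm
  have h3 : (velocity n γ a b t : EuclideanSpace ℝ (Fin (n + 1)))
      = mfderiv (𝓡 (n + 1)) (𝓡 (n + 1)) e.symm (e (γ t)) v := by
    have h4 := DFunLike.congr_fun (h2.mfderivWithin
      ((uniqueDiffOn_Icc hab t ht).uniqueMDiffWithinAt)) (1 : ℝ)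
    refine h4.trans ?_
    change mfderiv (𝓡 (n + 1)) (𝓡 (n + 1)) e.symm (e (γ t)) ((1 : ℝ) • v) = _
    rw [one_smul]
  exact g.inner_congr (e.left_inv (hγ ht)).symm h3 h3

/-- A geodesic in one chart is a geodesic in every other chart. -/
theorem geodesicEq_of_geodesicEq (he : e ∈ IsManifold.maximalAtlas (𝓡 (n + 1)) ∞ M)
    (he' : e' ∈ IsManifold.maximalAtlas (𝓡 (n + 1)) ∞ M) {c : ℝ → M} {a b t : ℝ} (hab : a < b)
    (hc : MapsTo c (Icc a b) e.source) (ht : t ∈ Icc a b) (hct : c t ∈ e'.source)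
    {v : ℝ → EuclideanSpace ℝ (Fin (n + 1))} {A : EuclideanSpace ℝ (Fin (n + 1))}
    (hv : ∀ s ∈ Icc a b, HasDerivWithinAt (e ∘ c) (v s) (Icc a b) s)
    (hA : HasDerivWithinAt v A (Icc a b) t)
    (h : GeodesicEq (g.coordMetric e) (e (c t)) (v t) A) :
    GeodesicEq (g.coordMetric e') (e' (c t)) (derivWithin (e' ∘ c) (Icc a b) t)
      (derivWithin (derivWithin (e' ∘ c) (Icc a b)) (Icc a b) t) := by
  obtain ⟨φ, hφ⟩ : ∃ φ, φ = e' ∘ e.symm := ⟨_, rfl⟩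
  have hu := uniqueDiffOn_Icc hab
  set W := e.target ∩ e.symm ⁻¹' e'.source with hW
  have hWo : IsOpen W := e.symm.isOpen_inter_preimage e'.open_source
  have hφW : ∀ y ∈ W, ContDiffAt ℝ ∞ φ y := fun y hy ↦
    hφ ▸ contDiffAt_transition he he' hy.1 hy.2
  have hxW : e (c t) ∈ W := ⟨e.map_source (hc ht), by
    rw [mem_preimage, e.left_inv (hc ht)]; exact hct⟩
  -- The curve may leave the second chart. Its velocity formula there holds only near `t`, which is
  -- all that the second derivative needs.
  have hev : ∀ s ∈ Icc a b, e (c s) ∈ W → ∀ᶠ s' in 𝓝[Icc a b] s, s' ∈ Icc a b ∧ e (c s') ∈ W :=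
    fun s hs hsW ↦ eventually_mem_nhdsWithin.and
      ((hv s hs).continuousWithinAt.eventually (hWo.mem_nhds hsW))
  have heq : ∀ s ∈ Icc a b, (e' ∘ c) s = (φ ∘ (e ∘ c)) s := fun s hs ↦ by
    simp only [hφ, Function.comp, e.left_inv (hc hs)]
  have hd1 : ∀ s ∈ Icc a b, e (c s) ∈ W →
      HasDerivWithinAt (e' ∘ c) (fderiv ℝ φ (e (c s)) (v s)) (Icc a b) s := fun s hs hsW ↦
    (((hφW _ hsW).differentiableAt (by simp)).hasFDerivAt.comp_hasDerivWithinAt s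
      (hv s hs)).congr heq (heq s hs)
  have hd2 : HasDerivWithinAt (fun s ↦ fderiv ℝ φ (e (c s)) (v s))
      (fderiv ℝ (fderiv ℝ φ) (e (c t)) (v t) (v t) + fderiv ℝ φ (e (c t)) A) (Icc a b) t := by
    have h1 : DifferentiableAt ℝ (fderiv ℝ φ) (e (c t)) :=
      ((hφW _ hxW).fderiv_right (m := 1) (WithTop.coe_le_coe.2 le_top)).differentiableAt one_ne_zero
    have h2 : HasDerivWithinAt (fun s ↦ fderiv ℝ φ (e (c s)))
        (fderiv ℝ (fderiv ℝ φ) (e (c t)) (v t)) (Icc a b) t :=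
      HasFDerivAt.comp_hasDerivWithinAt (l := fderiv ℝ φ) (f := e ∘ c) t h1.hasFDerivAt (hv t ht)
    exact h2.clm_apply hA
  have hd3 : derivWithin (e' ∘ c) (Icc a b) =ᶠ[𝓝[Icc a b] t]
      fun s ↦ fderiv ℝ φ (e (c s)) (v s) := by
    filter_upwards [hev t ht hxW] with s hs
    exact (hd1 s hs.1 hs.2).derivWithin (hu s hs.1)
  have hct' : e' (c t) = φ (e (c t)) := heq t ht
  rw [(hd1 t ht hxW).derivWithin (hu t ht), hd3.derivWithin_eq_of_mem ht,
    hd2.derivWithin (hu t ht), hct']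
  have hφt : φ (e (c t)) ∈ e'.target := hct' ▸ e'.map_source hct
  have hG : ∀ y ∈ W, ∀ u v, g.coordMetric e y u v
      = g.coordMetric e' (φ y) (fderiv ℝ φ y u) (fderiv ℝ φ y v) := fun y hy u v ↦ by
    subst hφ; exact g.coordMetric_eq_transition he he' hy.1 hy.2 u v
  refine h.map ((hφW _ hxW).of_le (WithTop.coe_le_coe.2 le_top))
    (g.differentiableAt_coordMetric he hxW.1) (g.differentiableAt_coordMetric he' hφt)
    (g.isLorentzForm_coordMetric he' hφt).symm ?_
    (Filter.eventually_of_mem (hWo.mem_nhds hxW) hG)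
  -- The derivative of the transition map is injective because it pulls one form back to a
  -- nondegenerate one. Equal dimensions make it surjective.
  refine (LinearMap.injective_iff_surjective (f := (fderiv ℝ φ (e (c t))).toLinearMap)).1 ?_
  rw [injective_iff_map_eq_zero]
  intro u hu0
  refine (injective_iff_map_eq_zero (g.coordMetric e (e (c t)))).1
    (g.isLorentzForm_coordMetric he hxW.1).injective u ?_
  ext w
  rw [hG _ hxW, show fderiv ℝ φ (e (c t)) u = 0 from hu0]
  simp

end LorentzianMetric

/-! ### Length of a curve with prescribed speed -/

section ProperTime

set_option maxSynthPendingDepth 3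

variable {n : ℕ} {E : Type*} [NormedAddCommGroup E] [InnerProductSpace ℝ E]
  {G : E → E →L[ℝ] E →L[ℝ] ℝ} {B : E → E →L[ℝ] E →L[ℝ] E} {C K r : ℝ} {y₀ : E}

/-- Used twice: with `φ = id` for the length of a geodesic, and with a parameter change for the
length of its reparametrization. -/
theorem IsTimelikeCurveIn.properTime_eq_mul (hb : IsSmallLorentzBall n G B C K r y₀)
    {γ γ' : ℝ → E} {a b : ℝ} (hγ : IsTimelikeCurveIn G (Metric.ball y₀ r) γ γ' a b) {κ : ℝ}
    {φ φ' : ℝ → ℝ} (hφ : ∀ t ∈ Icc a b, HasDerivWithinAt φ (φ' t) (Icc a b) t)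
    (hs : ∀ t ∈ Icc a b, √(-G (γ t) (γ' t) (γ' t)) = κ * φ' t) :
    IsTimelikeCurveIn.properTime G γ γ' a b = κ * (φ b - φ a) := by
  have hd : ∀ t ∈ Icc a b, HasDerivWithinAt
      (fun t ↦ IsTimelikeCurveIn.properTime G γ γ' a t - κ * φ t) 0 (Icc a b) t := fun t ht ↦ by
    refine ((hγ.hasDerivWithinAt_properTime hb ht).sub ((hφ t ht).const_mul κ)).congr_deriv ?_
    rw [hs t ht, sub_self]
  have := (convex_Icc a b).norm_image_sub_le_of_norm_hasDerivWithin_le hd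
    (fun t _ ↦ norm_zero.le) (left_mem_Icc.2 hγ.lt.le) (right_mem_Icc.2 hγ.lt.le)
  rw [zero_mul, norm_le_zero_iff, sub_eq_zero] at this
  have h0 : IsTimelikeCurveIn.properTime G γ γ' a a = 0 := by simp [IsTimelikeCurveIn.properTime]
  rw [h0] at this
  linarith

end ProperTime

section Charts

variable {n : ℕ} {M : Type*} [TopologicalSpace M]
  [ChartedSpace (EuclideanSpace ℝ (Fin (n + 1))) M]
  {e : OpenPartialHomeomorph M (EuclideanSpace ℝ (Fin (n + 1)))}

theorem contDiffOn_chart_comp (he : e ∈ IsManifold.maximalAtlas (𝓡 (n + 1)) ∞ M) {k : ℕ∞}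
    {γ : ℝ → M} {s : Set ℝ} (hγ : ContMDiffOn 𝓘(ℝ, ℝ) (𝓡 (n + 1)) k γ s)
    (hm : MapsTo γ s e.source) : ContDiffOn ℝ k (e ∘ γ) s :=
  contMDiffOn_iff_contDiffOn.1
    (((contMDiffOn_of_mem_maximalAtlas he).of_le (WithTop.coe_le_coe.2 le_top)).comp hγ hm)

theorem contMDiffOn_chart_symm_comp (he : e ∈ IsManifold.maximalAtlas (𝓡 (n + 1)) ∞ M) {k : ℕ∞}
    {x : ℝ → EuclideanSpace ℝ (Fin (n + 1))} {s : Set ℝ} (hx : ContDiffOn ℝ k x s)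
    (hm : MapsTo x s e.target) : ContMDiffOn 𝓘(ℝ, ℝ) (𝓡 (n + 1)) k (e.symm ∘ x) s :=
  ((contMDiffOn_symm_of_mem_maximalAtlas he).of_le (WithTop.coe_le_coe.2 le_top)).comp
    (contMDiffOn_iff_contDiffOn.2 hx) hm

end Charts

/-! ### Passage between curves in the manifold and in coordinates -/

namespace LorentzianMetric

set_option maxSynthPendingDepth 3

variable {n : ℕ} {M : Type*} [TopologicalSpace M]
  [ChartedSpace (EuclideanSpace ℝ (Fin (n + 1))) M] [IsManifold (𝓡 (n + 1)) ∞ M]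
  {g : LorentzianMetric n M}
  {e : OpenPartialHomeomorph M (EuclideanSpace ℝ (Fin (n + 1)))}
  {B : EuclideanSpace ℝ (Fin (n + 1)) → EuclideanSpace ℝ (Fin (n + 1)) →L[ℝ]
    EuclideanSpace ℝ (Fin (n + 1)) →L[ℝ] EuclideanSpace ℝ (Fin (n + 1))}
  {C K r : ℝ} {y₀ : EuclideanSpace ℝ (Fin (n + 1))} {p q : M}

/-- The domain of `M` that corresponds to a coordinate ball. -/
def chartBall (e : OpenPartialHomeomorph M (EuclideanSpace ℝ (Fin (n + 1))))
    (y₀ : EuclideanSpace ℝ (Fin (n + 1))) (r : ℝ) : Set M :=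
  e.source ∩ e ⁻¹' Metric.ball y₀ r

theorem IsTimelikeCurve.inChart (he : e ∈ IsManifold.maximalAtlas (𝓡 (n + 1)) ∞ M) {γ : ℝ → M}
    {a b : ℝ} (h : g.IsTimelikeCurve (chartBall e y₀ r) γ a b p q) :
    IsTimelikeCurveIn (g.coordMetric e) (Metric.ball y₀ r) (e ∘ γ)
      (derivWithin (e ∘ γ) (Icc a b)) a b := by
  have hm : MapsTo γ (Icc a b) e.source := fun t ht ↦ (h.mapsTo ht).1
  have hc := contDiffOn_chart_comp (k := 1) he h.contMDiffOn hm
  have hd : ∀ t ∈ Icc a b, HasDerivWithinAt (e ∘ γ) (derivWithin (e ∘ γ) (Icc a b) t) (Icc a b) t :=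
    fun t ht ↦ (hc.differentiableOn (by simp) t ht).hasDerivWithinAt
  refine ⟨h.lt, hd, hc.continuousOn_derivWithin (uniqueDiffOn_Icc h.lt) (by simp),
    fun t ht ↦ (h.mapsTo ht).2, fun t ht ↦ ?_⟩
  exact (g.inner_velocity he h.lt hm ht (hd t ht)).symm.trans_lt (h.timelike t ht)

theorem IsTimelikeCurve.length_eq (he : e ∈ IsManifold.maximalAtlas (𝓡 (n + 1)) ∞ M) {γ : ℝ → M}
    {a b : ℝ} (h : g.IsTimelikeCurve (chartBall e y₀ r) γ a b p q) :
    g.length γ a b = IsTimelikeCurveIn.properTime (g.coordMetric e) (e ∘ γ)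
      (derivWithin (e ∘ γ) (Icc a b)) a b := by
  have hm : MapsTo γ (Icc a b) e.source := fun t ht ↦ (h.mapsTo ht).1
  refine intervalIntegral.integral_congr fun t ht ↦ ?_
  rw [uIcc_of_le h.lt.le] at ht
  have h1 := h.timelike t ht
  rw [Timelike] at h1
  simp only [abs_of_neg h1]
  rw [g.inner_velocity he h.lt hm ht ((h.inChart he).hasDeriv t ht)]
  rfl

theorem isGeodesic_of_isSprayCurve (he : e ∈ IsManifold.maximalAtlas (𝓡 (n + 1)) ∞ M)
    (hb : IsSmallLorentzBall n (g.coordMetric e) B C K r y₀) (hr : Metric.ball y₀ r ⊆ e.target)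
    {x v : ℝ → EuclideanSpace ℝ (Fin (n + 1))} (h : IsSprayCurve B x v)
    (hx : ∀ t ∈ Icc (0 : ℝ) 1, x t ∈ Metric.ball y₀ r) :
    g.IsGeodesic (chartBall e y₀ r) (e.symm ∘ x) 0 1 (e.symm (x 0)) (e.symm (x 1)) := by
  have hu := uniqueDiffOn_Icc (zero_lt_one' ℝ)
  have hm : MapsTo x (Icc 0 1) e.target := fun t ht ↦ hr (hx t ht)
  have hms : MapsTo (e.symm ∘ x) (Icc 0 1) e.source := fun t ht ↦ e.map_target (hm ht)
  have hBc : Continuous B := continuous_of_norm_sub_le (by linarith [hb.one_le]) hb.lipschitz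
  have hx1 : ∀ t ∈ Icc (0 : ℝ) 1, derivWithin x (Icc 0 1) t = v t := fun t ht ↦
    (h.hasDeriv t ht).derivWithin (hu t ht)
  have hv1 : ∀ t ∈ Icc (0 : ℝ) 1, derivWithin v (Icc 0 1) t = B (x t) (v t) (v t) := fun t ht ↦
    (h.hasDeriv_vel t ht).derivWithin (hu t ht)
  have hv : ContDiffOn ℝ 1 v (Icc 0 1) := by
    rw [contDiffOn_one_iff_derivWithin hu]
    exact ⟨fun t ht ↦ (h.hasDeriv_vel t ht).differentiableWithinAt,
      (((hBc.comp_continuousOn h.continuousOn).clm_apply h.continuousOn_vel).clm_apply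
        h.continuousOn_vel).congr hv1⟩
  have hxc : ContDiffOn ℝ 2 x (Icc 0 1) := by
    refine (contDiffOn_succ_iff_derivWithin (n := 1) hu).2 ⟨fun t ht ↦ (h.hasDeriv t ht).differentiableWithinAt, by simp, hv.congr hx1⟩
  have hex : ∀ t ∈ Icc (0 : ℝ) 1, (e ∘ (e.symm ∘ x)) t = x t := fun t ht ↦ e.right_inv (hm ht)
  refine ⟨zero_lt_one, contMDiffOn_chart_symm_comp (k := 2) he hxc hm, fun t ht ↦ ⟨hms ht, ?_⟩,
    rfl, rfl, fun e' he' t ht hct ↦ ?_⟩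
  · exact (hex t ht).symm.subst (motive := (· ∈ Metric.ball y₀ r)) (hx t ht)
  -- `IsGeodesic` demands the equation in every chart of the atlas, so it is carried over from `e`.
  · have he' : e' ∈ IsManifold.maximalAtlas (𝓡 (n + 1)) ∞ M :=
      IsManifold.subset_maximalAtlas he'
    rw [← g.geodesicEq_coordMetric_iff he' (e'.map_source hct)]
    refine g.geodesicEq_of_geodesicEq he he' zero_lt_one hms ht hct
      (fun s hs ↦ (h.hasDeriv s hs).congr hex (hex s hs)) (h.hasDeriv_vel t ht) ?_
    have := hex t ht
    simp only [Function.comp] at this ⊢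
    rw [this, hb.geodesicEq_iff (hx t ht)]

/-- The energy of a geodesic is constant, so its sign at time 1 decides the causal character
throughout. -/
theorem isTimelikeCurve_of_isSprayCurve (he : e ∈ IsManifold.maximalAtlas (𝓡 (n + 1)) ∞ M)
    (hb : IsSmallLorentzBall n (g.coordMetric e) B C K r y₀) (hr : Metric.ball y₀ r ⊆ e.target)
    {x v : ℝ → EuclideanSpace ℝ (Fin (n + 1))} (h : IsSprayCurve B x v)
    (hx : ∀ t ∈ Icc (0 : ℝ) 1, x t ∈ Metric.ball y₀ r)
    (hneg : g.coordMetric e (x 1) (v 1) (v 1) < 0) :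
    g.IsTimelikeCurve (chartBall e y₀ r) (e.symm ∘ x) 0 1 (e.symm (x 0)) (e.symm (x 1)) := by
  have hg := isGeodesic_of_isSprayCurve he hb hr h hx
  have hex : ∀ t ∈ Icc (0 : ℝ) 1, (e ∘ (e.symm ∘ x)) t = x t := fun t ht ↦
    e.right_inv (hr (hx t ht))
  refine ⟨zero_lt_one, hg.contMDiffOn.of_le one_le_two, hg.mapsTo, rfl, rfl, fun t ht ↦ ?_⟩
  rw [Timelike, g.inner_velocity he zero_lt_one (fun s hs ↦ (hg.mapsTo hs).1) ht
    ((h.hasDeriv t ht).congr hex (hex t ht))]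
  have h1 : e ((e.symm ∘ x) t) = x t := hex t ht
  rw [h1, hb.energy_const h hx t ht]
  exact hneg

/-- A geodesic in a chart, reparametrized by `[0, 1]`. -/
theorem IsGeodesic.isSprayCurve (he : e ∈ IsManifold.maximalAtlas (𝓡 (n + 1)) ∞ M)
    (hea : e ∈ atlas (EuclideanSpace ℝ (Fin (n + 1))) M)
    (hb : IsSmallLorentzBall n (g.coordMetric e) B C K r y₀) {c : ℝ → M} {a b : ℝ}
    (h : g.IsGeodesic (chartBall e y₀ r) c a b p q) :
    IsSprayCurve B (fun s ↦ e (c (a + s * (b - a))))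
      (fun s ↦ (b - a) • derivWithin (e ∘ c) (Icc a b) (a + s * (b - a))) := by
  have hu := uniqueDiffOn_Icc h.lt
  have hba : 0 < b - a := sub_pos.2 h.lt
  have hm : MapsTo c (Icc a b) e.source := fun t ht ↦ (h.mapsTo ht).1
  have hc := contDiffOn_chart_comp (k := 2) he h.contMDiffOn hm
  have hd : ∀ t ∈ Icc a b, HasDerivWithinAt (e ∘ c) (derivWithin (e ∘ c) (Icc a b) t) (Icc a b) t :=
    fun t ht ↦ (hc.differentiableOn (by simp) t ht).hasDerivWithinAt
  have hd2 : ∀ t ∈ Icc a b, HasDerivWithinAt (derivWithin (e ∘ c) (Icc a b))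
      (B (e (c t)) (derivWithin (e ∘ c) (Icc a b) t) (derivWithin (e ∘ c) (Icc a b) t))
      (Icc a b) t := fun t ht ↦ by
    have h1 := ((hc.derivWithin hu (m := 1) one_add_one_eq_two.le).differentiableOn
      one_ne_zero t ht).hasDerivWithinAt
    refine h1.congr_deriv ((hb.geodesicEq_iff (h.mapsTo ht).2).1 ?_)
    exact (g.geodesicEq_coordMetric_iff he (e.map_source (hm ht))).2
      (h.geodesic_eq e hea t ht (hm ht))
  have hmaps : MapsTo (fun s ↦ a + s * (b - a)) (Icc (0 : ℝ) 1) (Icc a b) := fun s hs ↦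
    ⟨by nlinarith [hs.1], by nlinarith [hs.2]⟩
  have hl : ∀ s, HasDerivWithinAt (fun s ↦ a + s * (b - a)) (b - a) (Icc (0 : ℝ) 1) s := fun s ↦ by
    simpa using (((hasDerivAt_id s).mul_const (b - a)).const_add a).hasDerivWithinAt
  refine ⟨fun s hs ↦ HasDerivWithinAt.scomp (g₁ := e ∘ c)
    (h := fun s ↦ a + s * (b - a)) s (hd _ (hmaps hs)) (hl s) hmaps, fun s hs ↦ ?_⟩
  simp only [map_smul, smul_apply]
  exact ((hd2 _ (hmaps hs)).scomp s (hl s) hmaps).const_smul (b - a)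

end LorentzianMetric

/-! ### Convexity and maximality in the manifold -/

namespace LorentzianMetric

set_option maxSynthPendingDepth 3

variable {n : ℕ} {M : Type*} [TopologicalSpace M]
  [ChartedSpace (EuclideanSpace ℝ (Fin (n + 1))) M] [IsManifold (𝓡 (n + 1)) ∞ M]
  {g : LorentzianMetric n M}
  {e : OpenPartialHomeomorph M (EuclideanSpace ℝ (Fin (n + 1)))}
  {B : EuclideanSpace ℝ (Fin (n + 1)) → EuclideanSpace ℝ (Fin (n + 1)) →L[ℝ]
    EuclideanSpace ℝ (Fin (n + 1)) →L[ℝ] EuclideanSpace ℝ (Fin (n + 1))}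
  {C K r : ℝ} {y₀ : EuclideanSpace ℝ (Fin (n + 1))} {p q : M}

theorem IsGeodesic.mem_ball {c : ℝ → M} {a b : ℝ} (h : g.IsGeodesic (chartBall e y₀ r) c a b p q) :
    ∀ s ∈ Icc (0 : ℝ) 1, e (c (a + s * (b - a))) ∈ Metric.ball y₀ r := fun s hs ↦
  (h.mapsTo ⟨by nlinarith [h.lt, hs.1], by nlinarith [h.lt, hs.2]⟩).2

theorem geodesicallyConvex_chartBall (he : e ∈ IsManifold.maximalAtlas (𝓡 (n + 1)) ∞ M)
    (hea : e ∈ atlas (EuclideanSpace ℝ (Fin (n + 1))) M)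
    (hb : IsSmallLorentzBall n (g.coordMetric e) B C K r y₀) (hr : Metric.ball y₀ r ⊆ e.target) :
    g.GeodesicallyConvex (chartBall e y₀ r) := by
  refine fun p hp q hq ↦ ⟨?_, fun c c' h h' t ht ↦ ?_⟩
  · obtain ⟨x, v, h, h0, h1, hx⟩ := exists_isSprayCurve_mem_ball hb.bound hb.lipschitz hb.one_le
      hb.radius_le hp.2 hq.2
    have := isGeodesic_of_isSprayCurve he hb hr h hx
    rw [h0, h1, e.left_inv hp.1, e.left_inv hq.1] at this
    exact ⟨_, this⟩
  · have := (hb.unique (h.isSprayCurve he hea hb) h.mem_ball (h'.isSprayCurve he hea hb) h'.mem_ball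
      (by simp [h.source, h'.source]) (by simp [h.target, h'.target]) t ht).2
    simp only [sub_zero, mul_one, zero_add] at this
    exact e.injOn (h.mapsTo ht).1 (h'.mapsTo ht).1 this.symm

theorem IsTimelikeCurve.exists_geodesic (he : e ∈ IsManifold.maximalAtlas (𝓡 (n + 1)) ∞ M)
    (hb : IsSmallLorentzBall n (g.coordMetric e) B C K r y₀) (hr : Metric.ball y₀ r ⊆ e.target)
    {γ : ℝ → M} {a b : ℝ} (h : g.IsTimelikeCurve (chartBall e y₀ r) γ a b p q) :
    ∃ c : ℝ → M, g.IsGeodesic (chartBall e y₀ r) c 0 1 p q ∧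
      g.IsTimelikeCurve (chartBall e y₀ r) c 0 1 p q := by
  have hp : p ∈ chartBall e y₀ r := h.source ▸ h.mapsTo (left_mem_Icc.2 h.lt.le)
  have hq : q ∈ chartBall e y₀ r := h.target ▸ h.mapsTo (right_mem_Icc.2 h.lt.le)
  obtain ⟨x, v, hf⟩ := hb.exists_fan hp.2
  have hγ := h.inChart he
  have hneg := (hγ.neg hb (x := x) (v := v)
    (by simpa only [Function.comp, h.source] using hf) b (right_mem_Ioc.2 h.lt)).1
  simp only [Function.comp, h.target] at hneg
  have hs := hf.isSprayCurve _ hq.2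
  have hm := hf.mem _ hq.2
  have h1 := isGeodesic_of_isSprayCurve he hb hr hs hm
  have h2 := isTimelikeCurve_of_isSprayCurve he hb hr hs hm
    (by rw [hf.target _ hq.2]; exact hneg)
  rw [hf.source _ hq.2, hf.target _ hq.2, e.left_inv hp.1, e.left_inv hq.1] at h1 h2
  exact ⟨_, h1, h2⟩

/-- Timelike geodesics maximize proper time, and they are the only maximizers. -/
theorem IsTimelikeCurve.length_le (he : e ∈ IsManifold.maximalAtlas (𝓡 (n + 1)) ∞ M)
    (hea : e ∈ atlas (EuclideanSpace ℝ (Fin (n + 1))) M)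
    (hb : IsSmallLorentzBall n (g.coordMetric e) B C K r y₀)
    {c γ : ℝ → M} {a' b' a b : ℝ} (hc : g.IsGeodesic (chartBall e y₀ r) c a' b' p q)
    (hct : g.IsTimelikeCurve (chartBall e y₀ r) c a' b' p q)
    (h : g.IsTimelikeCurve (chartBall e y₀ r) γ a b p q) :
    g.length γ a b ≤ g.length c a' b' ∧
      (g.length γ a b = g.length c a' b' ↔ IsReparametrization γ a b c a' b') := by
  have hp : p ∈ chartBall e y₀ r := h.source ▸ h.mapsTo (left_mem_Icc.2 h.lt.le)
  have hq : q ∈ chartBall e y₀ r := h.target ▸ h.mapsTo (right_mem_Icc.2 h.lt.le)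
  have hl : 0 < b' - a' := sub_pos.2 hc.lt
  obtain ⟨x, v, hf⟩ := hb.exists_fan hp.2
  have hγ := h.inChart he
  have hγc := hct.inChart he
  have hfγ : IsGeodesicFan B y₀ r ((e ∘ γ) a) x v := by
    simpa only [Function.comp, h.source] using hf
  have hγb : (e ∘ γ) b = e q := congrArg e h.target
  set N := g.coordMetric e (e q) (v (e q) 1) (v (e q) 1) with hN
  -- By uniqueness, `c` rescaled to `[0, 1]` is the fan geodesic to `e q`. Its speed is therefore
  -- the constant `√(-N) / (b' - a')`.
  have hxc : ∀ s ∈ Icc (0 : ℝ) 1,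
      (b' - a') • derivWithin (e ∘ c) (Icc a' b') (a' + s * (b' - a')) = v (e q) s ∧
        e (c (a' + s * (b' - a'))) = x (e q) s := by
    have := hf.eq_of_isSprayCurve hb (hc.isSprayCurve he hea hb) hc.mem_ball (by simp [hc.source])
    simpa only [one_mul, add_sub_cancel, hc.target] using this
  have hspeed : ∀ t ∈ Icc a' b', √(-g.coordMetric e ((e ∘ c) t) (derivWithin (e ∘ c) (Icc a' b') t)
      (derivWithin (e ∘ c) (Icc a' b') t)) = √(-N) / (b' - a') := by
    intro t ht
    have hs : (t - a') / (b' - a') ∈ Icc (0 : ℝ) 1 :=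
      ⟨div_nonneg (sub_nonneg.2 ht.1) hl.le, (div_le_one hl).2 (by linarith [ht.2])⟩
    have hst : a' + (t - a') / (b' - a') * (b' - a') = t := by field_simp; ring
    obtain ⟨h1, h2⟩ := hxc _ hs
    rw [hst] at h1 h2
    have h3 := hb.energy_const (hf.isSprayCurve _ hq.2) (hf.mem _ hq.2) _ hs
    rw [hf.target _ hq.2, ← h1, ← h2, ← hN] at h3
    simp only [map_smul, smul_apply, smul_eq_mul] at h3
    rw [← h3, eq_div_iff hl.ne', ← Real.sqrt_sq hl.le, ← Real.sqrt_mul' _ (sq_nonneg _),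
      Real.sqrt_sq hl.le]
    congr 1
    simp only [Function.comp]
    ring
  have hlc : g.length c a' b' = √(-N) := by
    rw [hct.length_eq he, hγc.properTime_eq_mul hb (φ := id) (φ' := fun _ ↦ 1)
      (κ := √(-N) / (b' - a')) (fun t _ ↦ hasDerivWithinAt_id t _)
      (fun t ht ↦ by rw [mul_one]; exact hspeed t ht)]
    simp only [id]
    field_simp
  have hle := hγ.properTime_le hb hfγ
  rw [hγb, ← hN] at hle
  rw [hlc, h.length_eq he]
  refine ⟨hle, fun heq ↦ ?_, ?_⟩
  · obtain ⟨φ, hφ, hφ', hφa, hφb, hγφ⟩ := hγ.exists_reparametrization hb hfγ (by rw [heq, hγb, hN])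
    have hu := uniqueDiffOn_Icc h.lt
    have hφd : ∀ t ∈ Icc a b, HasDerivWithinAt φ (derivWithin φ (Icc a b) t) (Icc a b) t :=
      fun t ht ↦ (hφ.differentiableOn one_ne_zero t ht).hasDerivWithinAt
    have hmono : MonotoneOn φ (Icc a b) := monotoneOn_of_hasDerivWithinAt_nonneg (convex_Icc a b)
      hφ.continuousOn (fun t ht ↦ (hφd t (interior_subset ht)).mono interior_subset)
      (fun t ht ↦ (hφ' t (interior_subset ht)).le)
    -- The parameter change onto `[0, 1]` is followed by the affine map onto `[a', b']`.
    refine ⟨fun t ↦ a' + φ t * (b' - a'), contDiffOn_const.add (hφ.mul contDiffOn_const),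
      fun t ht ↦ ?_, by simp [hφa], by simp [hφb], fun t ht ↦ ?_⟩
    · rw [(((hφd t ht).mul_const (b' - a')).const_add a').derivWithin (hu t ht)]
      exact mul_pos (hφ' t ht) hl
    · have hm : φ t ∈ Icc (0 : ℝ) 1 :=
        ⟨hφa ▸ hmono (left_mem_Icc.2 h.lt.le) ht ht.1,
          hφb ▸ hmono ht (right_mem_Icc.2 h.lt.le) ht.2⟩
      refine e.injOn (h.mapsTo ht).1 (hc.mapsTo ⟨?_, ?_⟩).1 ?_
      · nlinarith [hm.1]
      · nlinarith [hm.2]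
      · rw [(hxc _ hm).2, ← hγb]
        exact hγφ t ht
  · rintro ⟨φ, hφ, hφ', hφa, hφb, hγφ⟩
    have hφd : ∀ t ∈ Icc a b, HasDerivWithinAt φ (derivWithin φ (Icc a b) t) (Icc a b) t :=
      fun t ht ↦ (hφ.differentiableOn one_ne_zero t ht).hasDerivWithinAt
    have hmono : MonotoneOn φ (Icc a b) := monotoneOn_of_hasDerivWithinAt_nonneg (convex_Icc a b)
      hφ.continuousOn (fun t ht ↦ (hφd t (interior_subset ht)).mono interior_subset)
      (fun t ht ↦ (hφ' t (interior_subset ht)).le)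
    have hm : MapsTo φ (Icc a b) (Icc a' b') := fun t ht ↦
      ⟨hφa ▸ hmono (left_mem_Icc.2 h.lt.le) ht ht.1, hφb ▸ hmono ht (right_mem_Icc.2 h.lt.le) ht.2⟩
    have hcomp : ∀ t ∈ Icc a b, (e ∘ γ) t = ((e ∘ c) ∘ φ) t := fun t ht ↦ congrArg e (hγφ t ht)
    have hvel : ∀ t ∈ Icc a b, derivWithin (e ∘ γ) (Icc a b) t
        = derivWithin φ (Icc a b) t • derivWithin (e ∘ c) (Icc a' b') (φ t) := fun t ht ↦
      (((hγc.hasDeriv _ (hm ht)).scomp t (hφd t ht) hm).congr hcomp (hcomp t ht)).derivWithin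
        (uniqueDiffOn_Icc h.lt t ht)
    -- By the chain rule the speed of `γ` is the constant speed of `c` times `φ'`.
    rw [hγ.properTime_eq_mul hb hφd (κ := √(-N) / (b' - a')) (fun t ht ↦ ?_), hφa, hφb]
    · field_simp
    · rw [← hspeed _ (hm ht), hvel t ht, hcomp t ht, mul_comm]
      simp only [map_smul, smul_apply, smul_eq_mul, Function.comp]
      conv_rhs => rw [← Real.sqrt_sq (hφ' t ht).le, ← Real.sqrt_mul (sq_nonneg _)]
      congr 1
      ring

end LorentzianMetric

end

theorem mainTheorem7 (n : ℕ) (M : Type*) [TopologicalSpace M]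
    [ChartedSpace (EuclideanSpace ℝ (Fin (n + 1))) M] [IsManifold (𝓡 (n + 1)) ∞ M]
    (g : LorentzianMetric n M) (o : g.TimeOrientation) (p₀ : M) :
    ∃ V : Set M, IsOpen V ∧ p₀ ∈ V ∧ g.GeodesicallyConvex V ∧
      ∀ p ∈ V, ∀ q ∈ o.chronologicalFuture V p,
        (∃ c : ℝ → M, g.IsGeodesic V c 0 1 p q ∧ g.IsTimelikeCurve V c 0 1 p q) ∧
        ∀ (c : ℝ → M) (a' b' : ℝ),
          g.IsGeodesic V c a' b' p q → g.IsTimelikeCurve V c a' b' p q →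
          ∀ (γ : ℝ → M) (a b : ℝ), g.IsTimelikeCurve V γ a b p q →
            g.length γ a b ≤ g.length c a' b' ∧
            (g.length γ a b = g.length c a' b' ↔ IsReparametrization γ a b c a' b') := by
  set e := chartAt (EuclideanSpace ℝ (Fin (n + 1))) p₀
  have hea : e ∈ atlas (EuclideanSpace ℝ (Fin (n + 1))) M := chart_mem_atlas _ p₀
  have he : e ∈ IsManifold.maximalAtlas (𝓡 (n + 1)) ∞ M := IsManifold.subset_maximalAtlas hea
  have hp₀ : p₀ ∈ e.source := mem_chart_source _ p₀
  obtain ⟨B, C, K, r, hb, hr⟩ := exists_isSmallLorentzBall e.open_target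
    (g.contDiffOn_coordMetric he) (fun y hy ↦ g.isLorentzForm_coordMetric he hy)
    (e.map_source hp₀)
  refine ⟨LorentzianMetric.chartBall e (e p₀) r, e.isOpen_inter_preimage Metric.isOpen_ball,
    ⟨hp₀, Metric.mem_ball_self hb.radius_pos⟩,
    LorentzianMetric.geodesicallyConvex_chartBall he hea hb hr, ?_⟩
  rintro p - q ⟨γ₀, a₀, b₀, hγ₀, -⟩
  exact ⟨hγ₀.exists_geodesic he hb hr, fun _ _ _ hc hct _ _ _ hγ ↦
    LorentzianMetric.IsTimelikeCurve.length_le he hea hb hc hct hγ⟩
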